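/- Let $S_\infty$ be the group of permutations of $\{1,2,\dots\}$ moving finitely many points, and let $\ell(w)$ be the number of inversions of $w$. For $w\in S_\infty$ let $1^n\times w$ be the permutation with $i\mapsto i$ for $i\le n$ and $n+i\mapsto n+w(i)$ for $i\ge 1$. Let $\mathfrak S_w(x)$ and $\mathfrak S_w(x,y)$ be the Schubert and the double Schubert polynomials: for $w\in S_N$ with longest element $w_0\in S_N$, $\mathfrak S_w(x)=\partial_{w^{-1}w_0}\big(x_1^{N-1}x_2^{N-2}\cdots x_{N-1}\big)$ and $\mathfrak S_w(x,y)=\partial_{w^{-1}w_0}\prod_{i+j\le N}(x_i-y_j)$, where the divided differences act on the $x$ variables. For a pair $p=(u,v)$ in $S_\infty\times S_\infty$ write $\mathfrak S_p=\mathfrak S_u(x)\,\mathfrak S_v(-y)$ and $1^n\times p=(1^n\times u,1^n\times v)$. Let $w_1,\dots,w_r\in S_\infty$ and $k=\ell(w_1)+\cdots+\ell(w_r)$. For every $n\ge 0$ the product of double Schubert polynomials $P_n=\prod_{t=1}^r\mathfrak S_{1^n\times w_t}(x,y)$ has a unique expansion $P_n=\sum_p c_n^p\,\mathfrak S_p$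 with integers $c_n^p$, only finitely many of them nonzero. Let $V_0=\{p: c_0^p\ne 0\}$, and for $i\ge 1$ let $V_i$ be the set of new pairs, i.e. of the $p$ with $c_i^p\neq 0$ that are not of the form $1\times q$ with $c_{i-1}^q\ne 0$. Then the expansion has the weak stable property: 1. For every $n\ge 0$, $$P_{n+1}=\sum_{p:\,c_n^p\neq 0}c_n^p\,\mathfrak S_{1\times p}+\sum_{p\in V_{n+1}}c_{n+1}^p\,\mathfrak S_p,$$ and every $(u,v)\in V_{n+1}$ satisfies $u(1)\ne 1$ or $v(1)\neq 1$. 2. For all $n\ge k$, $$P_n=\sum_{i=0}^{k}\ \sum_{p\in V_i}c_i^p\,\mathfrak S_{1^{n-i}\times p}.$$ -/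

import Mathlib

open MvPolynomial

/-- The group `S_∞` of permutations of `ℕ` that move only finitely many points. Positions and
values are numbered from `0`, so that `i : ℕ` stands for the letter `i + 1`; a permutation in `S_m`
is identified with its extension by fixed points. -/
def FinPerm : Subgroup (Equiv.Perm ℕ) where
  carrier := {w | {i | w i ≠ i}.Finite}
  one_mem' := by simp
  mul_mem' := by
    intro a b ha hb
    refine (Set.Finite.union ha hb).subset ?_
    intro i hi
    by_contra h
    simp only [Set.mem_union, Set.mem_ofPred_eq, not_or, not_not] at h
    apply hi
    rw [Equiv.Perm.mul_apply, h.2, h.1]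
  inv_mem' := by
    intro a ha
    refine Set.Finite.subset ha ?_
    intro i hi h
    apply hi
    rw [Equiv.Perm.inv_eq_iff_eq]
    exact h.symm

namespace FinPerm

/-- The simple transposition exchanging positions `i` and `i + 1`. -/
def simple (i : ℕ) : FinPerm :=
  ⟨Equiv.swap i (i + 1), (Set.toFinite {i, i + 1}).subset (by
    intro j hj
    by_contra h
    simp only [Set.mem_insert_iff, Set.mem_singleton_iff, not_or] at h
    exact hj (Equiv.swap_apply_of_ne_of_ne h.1 h.2))⟩

/-- The set of inversions of `w`. -/
def inversions (w : FinPerm) : Set (ℕ × ℕ) := {p | p.1 < p.2 ∧ w.1 p.2 < w.1 p.1}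

/-- The length `ℓ(w)`: the number of inversions. -/
noncomputable def length (w : FinPerm) : ℕ := (inversions w).ncard

/-- `w ∈ S_N` for some `N`. -/
theorem exists_bound (w : FinPerm) : ∃ N : ℕ, ∀ i, N ≤ i → w.1 i = i := by
  obtain ⟨N, hN⟩ := w.2.bddAbove
  refine ⟨N + 1, fun i hi => ?_⟩
  by_contra h
  have := hN h
  omega

open Classical in
/-- The least `N` with `w ∈ S_N`. -/
noncomputable def bound (w : FinPerm) : ℕ := Nat.find (exists_bound w)

/-- The longest element `N (N-1) ⋯ 2 1` of `S_N`. -/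
def longest (N : ℕ) : FinPerm :=
  ⟨{ toFun := fun i => if i < N then N - 1 - i else i
     invFun := fun i => if i < N then N - 1 - i else i
     left_inv := by intro i; grind
     right_inv := by intro i; grind },
   (Set.finite_lt_nat N).subset (by
    intro i hi
    by_contra h
    exact hi (if_neg h))⟩

/-- The permutation `1^n × w`: it fixes the first `n` letters and is `w`, shifted by `n`, on the
other letters. -/
def oneTimes (n : ℕ) (w : FinPerm) : FinPerm :=
  ⟨{ toFun := fun i => if i < n then i else w.1 (i - n) + n
     invFun := fun i => if i < n then i else w.1.symm (i - n) + n
     left_inv := by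
       intro i
       by_cases h : i < n
       · simp [h]
       · simp [h]; omega
     right_inv := by
       intro i
       by_cases h : i < n
       · simp [h]
       · simp [h]; omega },
   (w.2.image (· + n)).subset (by
    intro i hi
    have hn : ¬ i < n := fun h => hi (if_pos h)
    refine ⟨i - n, fun h => hi ?_, by simp; omega⟩
    show (if i < n then i else w.1 (i - n) + n) = i
    rw [if_neg hn, h]; omega)⟩

/-- `a = [a₁, …, a_p]` is a reduced word of `w`: `w = s_{a₁} ⋯ s_{a_p}` and `p = ℓ(w)`. -/
def IsReducedWord (a : List ℕ) (w : FinPerm) : Prop :=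
  (a.map simple).prod = w ∧ a.length = length w

theorem inversions_finite (w : FinPerm) : (inversions w).Finite := by
  obtain ⟨N, hN⟩ := exists_bound w
  refine ((Set.finite_lt_nat N).prod (Set.finite_lt_nat N)).subset ?_
  rintro ⟨i, j⟩ ⟨hij, hw⟩
  simp only at hij hw
  have hj : j < N := by
    by_contra h
    have h1 := hN j (by omega)
    have h2 : N ≤ w.1 i := by omega
    have h3 := w.1.injective (hN _ h2)
    omega
  exact ⟨show i < N by omega, hj⟩

theorem length_mul_simple (w : FinPerm) (i : ℕ) (h : w.1 (i + 1) < w.1 i) :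
    length (w * simple i) + 1 = length w := by
  have key : inversions w =
      insert (i, i + 1) (Prod.map (Equiv.swap i (i + 1)) (Equiv.swap i (i + 1)) ''
        inversions (w * simple i)) := by
    ext ⟨a, b⟩
    have hs : ∀ c, (w * simple i).1 c = w.1 (Equiv.swap i (i + 1) c) := fun c => rfl
    simp only [Set.mem_insert_iff, Set.mem_image, Prod.exists, Prod.map_apply, Prod.mk.injEq,
      inversions, Set.mem_ofPred_eq, hs]
    constructor
    · rintro ⟨hab, hw⟩
      by_cases hc : a = i ∧ b = i + 1
      · exact Or.inl hc
      · refine Or.inr ⟨Equiv.swap i (i + 1) a, Equiv.swap i (i + 1) b, ⟨?_, ?_⟩, ?_, ?_⟩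
        · simp only [Equiv.swap_apply_def]
          grind
        · simpa using hw
        · simp
        · simp
    · rintro (⟨rfl, rfl⟩ | ⟨c, d, ⟨hcd, hw⟩, rfl, rfl⟩)
      · exact ⟨by omega, h⟩
      · refine ⟨?_, hw⟩
        by_cases hc : c = i ∧ d = i + 1
        · obtain ⟨rfl, rfl⟩ := hc
          simp at hw
          omega
        · simp only [Equiv.swap_apply_def]
          grind
  have hinj : Function.Injective
      (Prod.map (Equiv.swap i (i + 1)) (Equiv.swap i (i + 1)) : ℕ × ℕ → ℕ × ℕ) :=
    (Equiv.injective _).prodMap (Equiv.injective _)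
  unfold length
  rw [key, Set.ncard_insert_of_notMem ?_ ((inversions_finite _).image _),
    Set.ncard_image_of_injective _ hinj]
  · rintro ⟨⟨c, d⟩, ⟨hcd, -⟩, hp⟩
    simp only [Prod.map_apply, Prod.mk.injEq] at hp hcd
    have h1 : c = i + 1 := by
      have := congrArg (Equiv.swap i (i + 1)) hp.1
      simpa using this
    have h2 : d = i := by
      have := congrArg (Equiv.swap i (i + 1)) hp.2
      simpa using this
    omega

theorem exists_isReducedWord (w : FinPerm) : ∃ a, IsReducedWord a w := by
  induction hl : length w using Nat.strong_induction_on generalizing w with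
  | _ l ih =>
    by_cases hd : ∃ i, w.1 (i + 1) < w.1 i
    · obtain ⟨i, hi⟩ := hd
      have h1 := length_mul_simple w i hi
      obtain ⟨a, ha, hal⟩ := ih _ (by omega) (w * simple i) rfl
      refine ⟨a ++ [i], ?_, ?_⟩
      · rw [List.map_append, List.prod_append, ha]
        apply Subtype.ext
        simp [simple, mul_assoc]
      · simp [hal, h1]
    · have hm : StrictMono w.1 := strictMono_nat_of_lt_succ fun i => by
        have h1 : w.1 i ≤ w.1 (i + 1) := by
          by_contra h
          exact hd ⟨i, by omega⟩
        have h2 : w.1 i ≠ w.1 (i + 1) := fun h => by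
          have := w.1.injective h
          omega
        omega
      have h0 : length w = 0 := by
        have : inversions w = ∅ := by
          ext ⟨a, b⟩
          simp only [inversions, Set.mem_ofPred_eq, Set.mem_empty_iff_false, iff_false, not_and]
          intro hab
          have := hm hab
          omega
        simp [length, this]
      have hw : w = 1 := by
        obtain ⟨N, hN⟩ := exists_bound w
        apply Subtype.ext
        ext i
        have hle : ∀ j, j ≤ w.1 j := fun j => hm.le_apply
        have hup : ∀ d j, w.1 j + d ≤ w.1 (j + d) := by
          intro d j
          induction d with
          | zero => simp
          | succ d ihd =>
            have := hm (show j + d < j + (d + 1) by omega)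
            omega
        have h1 := hup N i
        have h2 := hN (i + N) (by omega)
        have h3 := hle i
        show w.1 i = i
        omega
      exact ⟨[], by simp [hw], by simp [h0]⟩

/-- A reduced word of `w`. -/
noncomputable def reducedWord (w : FinPerm) : List ℕ := (exists_isReducedWord w).choose

end FinPerm

section DividedDifference

variable {σ : Type} [DecidableEq σ]

theorem X_sub_X_dvd_sub_rename_swap (a b : σ) (f : MvPolynomial σ ℤ) :
    (X a - X b : MvPolynomial σ ℤ) ∣ f - rename (Equiv.swap a b) f := by
  induction f using MvPolynomial.induction_on with
  | C r => simp
  | add p q hp hq =>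
    have : p + q - rename (Equiv.swap a b) (p + q) =
        (p - rename (Equiv.swap a b) p) + (q - rename (Equiv.swap a b) q) := by
      rw [map_add]; ring
    rw [this]
    exact dvd_add hp hq
  | mul_X p c hp =>
    have : p * X c - rename (Equiv.swap a b) (p * X c) =
        (p - rename (Equiv.swap a b) p) * X c +
          rename (Equiv.swap a b) p * (X c - X (Equiv.swap a b c)) := by
      rw [map_mul, rename_X]; ring
    rw [this]
    refine dvd_add (Dvd.dvd.mul_right hp _) (Dvd.dvd.mul_left ?_ _)
    by_cases ha : c = a
    · subst ha; simp
    · by_cases hb : c = b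
      · subst hb
        rw [Equiv.swap_apply_right]
        exact ⟨-1, by ring⟩
      · rw [Equiv.swap_apply_of_ne_of_ne ha hb]; simp

/-- The divided difference `(f - f|_{x_a ↔ x_b}) / (x_a - x_b)`, for distinct variables `a`, `b`. -/
noncomputable def divDiff (a b : σ) (f : MvPolynomial σ ℤ) : MvPolynomial σ ℤ :=
  (X_sub_X_dvd_sub_rename_swap a b f).choose

/-- `divDiff a b f` really is the quotient; for `a ≠ b` this equation determines it. -/
theorem sub_mul_divDiff (a b : σ) (f : MvPolynomial σ ℤ) :
    (X a - X b) * divDiff a b f = f - rename (Equiv.swap a b) f :=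
  (X_sub_X_dvd_sub_rename_swap a b f).choose_spec.symm

/-- The operator `∂_w = ∂_{a₁} ∘ ⋯ ∘ ∂_{a_p}` for a reduced word `a₁ ⋯ a_p` of `w` (it does not
depend on the word), where `∂_i` is the divided difference in the variables number `i` and `i + 1`
of the sequence `x` of variables. -/
noncomputable def divDiffPerm (x : ℕ → σ) (w : FinPerm) (f : MvPolynomial σ ℤ) :
    MvPolynomial σ ℤ :=
  (FinPerm.reducedWord w).foldr (fun i g => divDiff (x i) (x (i + 1)) g) f

end DividedDifference

/-- The Schubert polynomial `𝔖_w(x) = ∂_{w⁻¹w₀} (x₁^{N-1} x₂^{N-2} ⋯ x_{N-1})`, where `w ∈ S_N`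
and `w₀` is the longest element of `S_N` (it does not depend on `N`). -/
noncomputable def schubert (w : FinPerm) : MvPolynomial ℕ ℤ :=
  divDiffPerm id (w⁻¹ * FinPerm.longest (FinPerm.bound w))
    (∏ i ∈ Finset.range (FinPerm.bound w), X i ^ (FinPerm.bound w - 1 - i))

/-- The double Schubert polynomial
`𝔖_w(x, y) = ∂_{w⁻¹w₀} ∏_{i + j ≤ N} (x_i - y_j)`, where `w ∈ S_N`, `w₀` is the longest element of
`S_N`, the indices `i, j` start at `1`, and the divided differences act on the variables `x`. The
variables `x` are `X (Sum.inl i)`, the variables `y` are `X (Sum.inr j)`. -/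
noncomputable def doubleSchubert (w : FinPerm) : MvPolynomial (ℕ ⊕ ℕ) ℤ :=
  divDiffPerm Sum.inl (w⁻¹ * FinPerm.longest (FinPerm.bound w))
    (∏ i ∈ Finset.range (FinPerm.bound w), ∏ j ∈ Finset.range (FinPerm.bound w - 1 - i),
      (X (Sum.inl i) - X (Sum.inr j)))

/-- The product `𝔖_u(x) 𝔖_v(-y)` for a pair `p = (u, v)`. -/
noncomputable def schubertPair (p : FinPerm × FinPerm) : MvPolynomial (ℕ ⊕ ℕ) ℤ :=
  rename Sum.inl (schubert p.1) * aeval (fun j => -X (Sum.inr j)) (schubert p.2)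

/-- The pair `(1^n × u, 1^n × v)`. -/
def oneTimesPair (n : ℕ) (p : FinPerm × FinPerm) : FinPerm × FinPerm :=
  (FinPerm.oneTimes n p.1, FinPerm.oneTimes n p.2)

open Classical in
/-- For a sequence of coefficient families `c 0, c 1, …`, the set `V_i` of new pairs: `V_0` is the
support of `c 0`, and `V_{i+1}` consists of the pairs in the support of `c (i + 1)` that are not
`(1 × u, 1 × v)` for a pair `(u, v)` in the support of `c i`. -/
noncomputable def newPairs (c : ℕ → (FinPerm × FinPerm →₀ ℤ)) : ℕ → Finset (FinPerm × FinPerm)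
  | 0 => (c 0).support
  | i + 1 => (c (i + 1)).support \ (c i).support.image (oneTimesPair 1)

/-! ### Permutations of finite support: descents, reduced words, longest elements, shifts -/

namespace FinPerm

/-! The proof has two sources: a specialization that relates `P_{n+1}` to `P_n`, and a degree bound.

Specialization: set the first `x` and the first `y` to zero and lower all other indices by one. This
sends the double Schubert polynomial of `1 × w` to that of `w`, sends `𝔖_{1×p}` to `𝔖_p`, and kills
`𝔖_{(u,v)}` as soon as `u` or `v` moves the first letter. Hence `P_{n+1}` goes to `P_n`, and
comparing coordinates in the basis `𝔖_p` gives `c_{n+1}^{1×p} = c_n^p`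
(`productExpansion_succ_oneTimesPair`). So the old terms reappear unchanged, and a new pair cannot
fix the first letter in both components.

Degree bound: up to sign, the coefficient of `𝔖_{(u,v)}` is the constant term of `∂_u` in `x`
applied to `∂_v` in `y` of `P_n`. The product `P_n` has degree at most `k` and is symmetric in the
first `n` variables `x` and in the first `n` variables `y`. A nonzero coefficient therefore forces
`u` and `v` to increase on the first `n` letters and to have length at most `k`. A permutation that
increases on `n` letters and moves the first one has at least `n` inversions
(`le_length_of_forall_lt`), so no new pairs exist for `n > k` (`newPairs_eq_empty`).

Both rest on how divided differences act on double Schubert polynomials: `∂_i` in `x` takes `w` to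
`w s_i` at a descent, `∂_j` in `y` takes `w` to `s_j w` with a sign, and both vanish otherwise.
Since a polynomial killed by all divided differences is constant, identities follow by induction,
comparing divided differences and constant terms. The same principle makes the functionals "constant
term of `∂_w`" a dual family and yields the basis. -/

theorem coe_mul_apply (v w : FinPerm) (i : ℕ) : (v * w).1 i = v.1 (w.1 i) := rfl

theorem coe_one_apply (i : ℕ) : (1 : FinPerm).1 i = i := rfl

theorem coe_inv_apply_self (w : FinPerm) (i : ℕ) : (w⁻¹).1 (w.1 i) = i :=
  Equiv.symm_apply_apply w.1 i

theorem coe_apply_inv_self (w : FinPerm) (i : ℕ) : w.1 ((w⁻¹).1 i) = i :=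
  Equiv.apply_symm_apply w.1 i

theorem ext_apply {v w : FinPerm} (h : ∀ i, v.1 i = w.1 i) : v = w :=
  Subtype.ext (Equiv.ext h)

theorem simple_apply (i j : ℕ) : (simple i).1 j = Equiv.swap i (i + 1) j := rfl

@[simp]
theorem simple_mul_simple (i : ℕ) : simple i * simple i = 1 :=
  ext_apply fun j => by simp [simple_apply]

theorem mul_simple_mul_simple (w : FinPerm) (i : ℕ) : w * simple i * simple i = w := by
  rw [mul_assoc, simple_mul_simple, mul_one]

theorem simple_inv (i : ℕ) : (simple i)⁻¹ = simple i :=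
  inv_eq_of_mul_eq_one_left (simple_mul_simple i)

theorem mul_simple_apply_left (w : FinPerm) (i : ℕ) : (w * simple i).1 i = w.1 (i + 1) := by
  simp [simple_apply]

theorem mul_simple_apply_right (w : FinPerm) (i : ℕ) : (w * simple i).1 (i + 1) = w.1 i := by
  simp [simple_apply]

theorem mul_simple_apply_of_ne (w : FinPerm) {i j : ℕ} (h : j ≠ i) (h' : j ≠ i + 1) :
    (w * simple i).1 j = w.1 j := by
  rw [coe_mul_apply, simple_apply, Equiv.swap_apply_of_ne_of_ne h h']

theorem simple_commute {i j : ℕ} (h : i + 1 < j) : simple i * simple j = simple j * simple i :=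
  ext_apply fun k => by
    simp only [coe_mul_apply, simple_apply, Equiv.swap_apply_def]
    grind

theorem simple_braid (i : ℕ) :
    simple i * simple (i + 1) * simple i = simple (i + 1) * simple i * simple (i + 1) :=
  ext_apply fun k => by
    simp only [coe_mul_apply, simple_apply, Equiv.swap_apply_def]
    grind

theorem apply_lt_or_gt (w : FinPerm) (i : ℕ) : w.1 i < w.1 (i + 1) ∨ w.1 (i + 1) < w.1 i := by
  have : w.1 i ≠ w.1 (i + 1) := fun h => by
    have := w.1.injective h
    omega
  omega

theorem length_mul_simple_of_lt (w : FinPerm) (i : ℕ) (h : w.1 i < w.1 (i + 1)) :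
    length (w * simple i) = length w + 1 := by
  have := length_mul_simple (w * simple i) i
    (by rwa [mul_simple_apply_left, mul_simple_apply_right])
  rw [mul_simple_mul_simple] at this
  exact this.symm

theorem length_mul_simple_le (w : FinPerm) (i : ℕ) : length (w * simple i) ≤ length w + 1 := by
  rcases apply_lt_or_gt w i with h | h
  · exact (length_mul_simple_of_lt w i h).le
  · have := length_mul_simple w i h
    omega

@[simp]
theorem length_one : length 1 = 0 := by
  have : inversions 1 = ∅ := by
    ext ⟨a, b⟩
    simp only [inversions, Set.mem_ofPred_eq, Set.mem_empty_iff_false, iff_false, coe_one_apply]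
    omega
  simp [length, this]

theorem length_prod_le (a : List ℕ) : length (a.map simple).prod ≤ a.length := by
  induction a using List.reverseRecOn with
  | nil => simp
  | append_singleton a i ih =>
    have := length_mul_simple_le (a.map simple).prod i
    simp only [List.map_append, List.prod_append, List.map_cons, List.map_nil, List.prod_singleton,
      List.length_append, List.length_singleton]
    omega

theorem length_inv (w : FinPerm) : length w⁻¹ = length w := by
  have : inversions w⁻¹ = (fun p : ℕ × ℕ => (w.1 p.2, w.1 p.1)) '' inversions w := by
    ext ⟨a, b⟩
    simp only [inversions, Set.mem_ofPred_eq, Set.mem_image, Prod.mk.injEq, Prod.exists]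
    constructor
    · rintro ⟨h1, h2⟩
      exact ⟨(w⁻¹).1 b, (w⁻¹).1 a, ⟨h2, by simpa only [coe_apply_inv_self] using h1⟩,
        coe_apply_inv_self w a, coe_apply_inv_self w b⟩
    · rintro ⟨c, d, ⟨h1, h2⟩, rfl, rfl⟩
      exact ⟨h2, by simpa only [coe_inv_apply_self] using h1⟩
  rw [length, this, Set.ncard_image_of_injective]
  · rfl
  · rintro ⟨a, b⟩ ⟨c, d⟩ h
    simp only [Prod.mk.injEq, EmbeddingLike.apply_eq_iff_eq] at h
    simp [h.1, h.2]

theorem simple_mul_eq_inv (w : FinPerm) (i : ℕ) : simple i * w = (w⁻¹ * simple i)⁻¹ := by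
  rw [mul_inv_rev, simple_inv, inv_inv]

theorem length_simple_mul_of_lt (w : FinPerm) (i : ℕ) (h : (w⁻¹).1 i < (w⁻¹).1 (i + 1)) :
    length (simple i * w) = length w + 1 := by
  rw [simple_mul_eq_inv, length_inv, length_mul_simple_of_lt _ _ h, length_inv]

theorem length_simple_mul (w : FinPerm) (i : ℕ) (h : (w⁻¹).1 (i + 1) < (w⁻¹).1 i) :
    length (simple i * w) + 1 = length w := by
  rw [simple_mul_eq_inv, length_inv, length_mul_simple _ _ h, length_inv]

theorem isReducedWord_one : IsReducedWord [] 1 := ⟨rfl, by simp⟩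

theorem IsReducedWord.append {a : List ℕ} {w : FinPerm} (ha : IsReducedWord a w) {i : ℕ}
    (h : w.1 i < w.1 (i + 1)) : IsReducedWord (a ++ [i]) (w * simple i) :=
  ⟨by simp [ha.1], by simp [ha.2, length_mul_simple_of_lt w i h]⟩

theorem IsReducedWord.cons {a : List ℕ} {w : FinPerm} (ha : IsReducedWord a w) {i : ℕ}
    (h : (w⁻¹).1 i < (w⁻¹).1 (i + 1)) : IsReducedWord (i :: a) (simple i * w) :=
  ⟨by simp [ha.1], by simp [ha.2, length_simple_mul_of_lt w i h]⟩

theorem IsReducedWord.of_append {a : List ℕ} {w : FinPerm} {i : ℕ}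
    (h : IsReducedWord (a ++ [i]) w) :
    w.1 (i + 1) < w.1 i ∧ IsReducedWord a (w * simple i) := by
  have hp : (a.map simple).prod = w * simple i := by
    rw [← h.1]
    simp [mul_assoc]
  have hl := length_prod_le a
  have hw := h.2
  rw [hp] at hl
  simp only [List.length_append, List.length_singleton] at hw
  have hd : w.1 (i + 1) < w.1 i := by
    rcases apply_lt_or_gt w i with h1 | h1
    · have := length_mul_simple_of_lt w i h1
      omega
    · exact h1
  have := length_mul_simple w i hd
  exact ⟨hd, hp, by omega⟩

theorem exists_descent {w : FinPerm} (h : w ≠ 1) : ∃ i, w.1 (i + 1) < w.1 i := by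
  obtain ⟨a, ha⟩ := exists_isReducedWord w
  rcases List.eq_nil_or_concat a with rfl | ⟨b, i, rfl⟩
  · exact absurd ha.1.symm h
  · rw [List.concat_eq_append] at ha
    exact ⟨i, ha.of_append.1⟩

/-- Induction on the length, from `w * simple i` to `w` at the descents `i` of `w`. -/
theorem descent_induction {P : FinPerm → Prop} (one : P 1)
    (descent : ∀ w i, w.1 (i + 1) < w.1 i → P (w * simple i) → P w) (w : FinPerm) : P w := by
  induction hl : length w using Nat.strong_induction_on generalizing w with
  | _ l ih =>
    by_cases h : w = 1
    · exact h ▸ one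
    · obtain ⟨i, hi⟩ := exists_descent h
      have := length_mul_simple w i hi
      exact descent w i hi (ih _ (by omega) _ rfl)

theorem bound_spec (w : FinPerm) : ∀ i, bound w ≤ i → w.1 i = i := by
  classical
  exact Nat.find_spec (exists_bound w)

theorem bound_le {w : FinPerm} {N : ℕ} (h : ∀ i, N ≤ i → w.1 i = i) : bound w ≤ N := by
  classical
  exact Nat.find_le h

theorem apply_of_bound_le {w : FinPerm} {N : ℕ} (h : bound w ≤ N) {i : ℕ} (hi : N ≤ i) :
    w.1 i = i := bound_spec w i (h.trans hi)

theorem bound_one : bound 1 = 0 := Nat.le_zero.1 (bound_le fun _ _ => rfl)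

theorem inv_apply_eq_self {w : FinPerm} {i : ℕ} (h : w.1 i = i) : (w⁻¹).1 i = i := by
  conv_lhs => rw [← h]
  exact coe_inv_apply_self w i

theorem longest_apply (N i : ℕ) : (longest N).1 i = if i < N then N - 1 - i else i := rfl

theorem longest_mul_longest (N : ℕ) : longest N * longest N = 1 :=
  ext_apply fun i => by
    simp only [coe_mul_apply, longest_apply, coe_one_apply]
    grind

theorem longest_inv (N : ℕ) : (longest N)⁻¹ = longest N :=
  inv_eq_of_mul_eq_one_left (longest_mul_longest N)

/-- Conjugation by the longest element reverses the simple transpositions. This matches divided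
differences in `y` with those in `x` on the staircase product. -/
theorem simple_mul_longest {N j : ℕ} (h : j + 1 < N) :
    simple j * longest N = longest N * simple (N - 2 - j) :=
  ext_apply fun i => by
    simp only [coe_mul_apply, longest_apply, simple_apply, Equiv.swap_apply_def]
    grind

theorem oneTimes_apply (n : ℕ) (w : FinPerm) (i : ℕ) :
    (oneTimes n w).1 i = if i < n then i else w.1 (i - n) + n := rfl

theorem oneTimes_apply_lt (w : FinPerm) {n i : ℕ} (h : i < n) : (oneTimes n w).1 i = i :=
  if_pos h

theorem oneTimes_inv (n : ℕ) (w : FinPerm) : (oneTimes n w)⁻¹ = oneTimes n w⁻¹ := rfl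

theorem oneTimes_mul (n : ℕ) (v w : FinPerm) :
    oneTimes n (v * w) = oneTimes n v * oneTimes n w :=
  ext_apply fun i => by
    simp only [coe_mul_apply, oneTimes_apply]
    by_cases h : i < n <;> simp [h]

theorem oneTimes_one (n : ℕ) : oneTimes n 1 = 1 :=
  ext_apply fun i => by
    simp only [coe_one_apply, oneTimes_apply]
    grind

theorem oneTimes_simple (n i : ℕ) : oneTimes n (simple i) = simple (i + n) :=
  ext_apply fun j => by
    simp only [simple_apply, oneTimes_apply, Equiv.swap_apply_def]
    grind

theorem oneTimes_zero (w : FinPerm) : oneTimes 0 w = w :=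
  ext_apply fun i => by simp [oneTimes_apply]

theorem oneTimes_oneTimes (m n : ℕ) (w : FinPerm) :
    oneTimes m (oneTimes n w) = oneTimes (m + n) w :=
  ext_apply fun i => by
    simp only [oneTimes_apply]
    grind

theorem oneTimes_injective (n : ℕ) : Function.Injective (oneTimes n) := fun v w h =>
  ext_apply fun i => by
    have := congrArg (fun u : FinPerm => u.1 (i + n)) h
    simpa [oneTimes_apply] using this

theorem oneTimes_one_succ (w : FinPerm) (i : ℕ) : (oneTimes 1 w).1 (i + 1) = w.1 i + 1 := by
  simp [oneTimes_apply]

/-- A permutation that fixes the first letter is of the form `1 × v`. -/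
theorem exists_eq_oneTimes_one {w : FinPerm} (h : w.1 0 = 0) : ∃ v, w = oneTimes 1 v := by
  have pos : ∀ u : FinPerm, u.1 0 = 0 → ∀ i, u.1 (i + 1) - 1 + 1 = u.1 (i + 1) := by
    intro u hu i
    have : u.1 (i + 1) ≠ 0 := fun h0 => by
      have := u.1.injective (h0.trans hu.symm)
      omega
    omega
  have h' : (w⁻¹).1 0 = 0 := inv_apply_eq_self h
  refine ⟨⟨⟨fun i => w.1 (i + 1) - 1, fun i => (w⁻¹).1 (i + 1) - 1, fun i => ?_, fun i => ?_⟩, ?_⟩,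
    ?_⟩
  · simp only [pos w h, coe_inv_apply_self, Nat.add_sub_cancel]
  · simp only [pos w⁻¹ h', coe_apply_inv_self, Nat.add_sub_cancel]
  · obtain ⟨N, hN⟩ := exists_bound w
    refine (Set.finite_lt_nat N).subset fun i hi => ?_
    by_contra hlt
    refine hi ?_
    show w.1 (i + 1) - 1 = i
    have : ¬ i < N := hlt
    rw [hN (i + 1) (by omega)]
    omega
  · refine ext_apply fun i => ?_
    cases i with
    | zero => rw [h]; rfl
    | succ i => rw [oneTimes_one_succ]; exact (pos w h i).symm

/-- A permutation that is increasing on the first `n` letters and does not fix the first one has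
at least `n` inversions. -/
theorem le_length_of_forall_lt {w : FinPerm} {n : ℕ} (h : ∀ i, i + 1 < n → w.1 i < w.1 (i + 1))
    (h0 : w.1 0 ≠ 0) : n ≤ length w := by
  have hpos : ∀ i, i < n → 0 < w.1 i := by
    intro i
    induction i with
    | zero => omega
    | succ i ih =>
      intro hi
      have := ih (by omega)
      have := h i hi
      omega
  have hm : w.1 ((w⁻¹).1 0) = 0 := coe_apply_inv_self w 0
  -- The first `n` values are positive, so the value `0` sits at a later position and forms an
  -- inversion with each of the first `n` positions.
  have hsub : (fun i => (i, (w⁻¹).1 0)) '' (Finset.range n : Set ℕ) ⊆ inversions w := by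
    rintro _ ⟨i, hi, rfl⟩
    have hi' : i < n := by simpa using hi
    refine ⟨?_, by simpa only [hm] using hpos i hi'⟩
    by_contra hle
    have := hpos ((w⁻¹).1 0) (by simp only at hle; omega)
    omega
  have := Set.ncard_le_ncard hsub (inversions_finite w)
  rwa [Set.ncard_image_of_injective _ (fun a b hab => (Prod.mk.inj hab).1),
    Set.ncard_coe_finset, Finset.card_range] at this

end FinPerm

/-! ### Divided differences in two variables -/

section DividedDifferenceLemmas

variable {σ τ : Type}

theorem X_sub_X_ne_zero {a b : σ} (h : a ≠ b) : (X a - X b : MvPolynomial σ ℤ) ≠ 0 :=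
  sub_ne_zero.2 fun hab => h (X_injective hab)

variable [DecidableEq σ] [DecidableEq τ]

/-- The factor `X a - X b` cancels in a domain, so the chosen quotient is determined; most
identities for divided differences are checked this way. -/
theorem divDiff_eq_of_mul_eq {a b : σ} (h : a ≠ b) {f g : MvPolynomial σ ℤ}
    (hg : (X a - X b) * g = f - rename (Equiv.swap a b) f) : divDiff a b f = g :=
  mul_left_cancel₀ (X_sub_X_ne_zero h) ((sub_mul_divDiff a b f).trans hg.symm)

theorem divDiff_add {a b : σ} (h : a ≠ b) (f g : MvPolynomial σ ℤ) :
    divDiff a b (f + g) = divDiff a b f + divDiff a b g :=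
  divDiff_eq_of_mul_eq h (by rw [mul_add, sub_mul_divDiff, sub_mul_divDiff, map_add]; ring)

theorem rename_swap_swap (a b : σ) (f : MvPolynomial σ ℤ) :
    rename (Equiv.swap a b) (rename (Equiv.swap a b) f) = f := by
  have : (Equiv.swap a b : σ → σ) ∘ Equiv.swap a b = id := funext (Equiv.swap_apply_self a b)
  rw [rename_rename, this, rename_id_apply]

theorem divDiff_eq_zero_iff {a b : σ} (h : a ≠ b) {f : MvPolynomial σ ℤ} :
    divDiff a b f = 0 ↔ rename (Equiv.swap a b) f = f := by
  constructor
  · intro h0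
    have := sub_mul_divDiff a b f
    rw [h0, mul_zero] at this
    exact (sub_eq_zero.1 this.symm).symm
  · intro hf
    exact divDiff_eq_of_mul_eq h (by rw [hf, mul_zero, sub_self])

/-- A divided difference is linear over the invariants of its transposition. -/
theorem divDiff_mul_of_rename_eq {a b : σ} (h : a ≠ b) {g : MvPolynomial σ ℤ}
    (hg : rename (Equiv.swap a b) g = g) (f : MvPolynomial σ ℤ) :
    divDiff a b (f * g) = divDiff a b f * g :=
  divDiff_eq_of_mul_eq h (by rw [← mul_assoc, sub_mul_divDiff, map_mul, hg]; ring)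

theorem rename_divDiff_self {a b : σ} (h : a ≠ b) (f : MvPolynomial σ ℤ) :
    rename (Equiv.swap a b) (divDiff a b f) = divDiff a b f := by
  symm
  refine divDiff_eq_of_mul_eq h ?_
  have := congrArg (rename (Equiv.swap a b)) (sub_mul_divDiff a b f)
  simp only [map_mul, map_sub, rename_X, Equiv.swap_apply_left, Equiv.swap_apply_right,
    rename_swap_swap] at this
  linear_combination -this

theorem divDiff_divDiff_self {a b : σ} (h : a ≠ b) (f : MvPolynomial σ ℤ) :
    divDiff a b (divDiff a b f) = 0 :=
  (divDiff_eq_zero_iff h).2 (rename_divDiff_self h f)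

/-- An algebra homomorphism that intertwines two transpositions and sends `X a - X b` to
`e * (X c - X d)` intertwines the divided differences up to `e`. -/
theorem mul_algHom_divDiff {a b : σ} {c d : τ} (h : c ≠ d)
    (φ : MvPolynomial σ ℤ →ₐ[ℤ] MvPolynomial τ ℤ) (e : MvPolynomial τ ℤ)
    (hsub : φ (X a) - φ (X b) = e * (X c - X d))
    (hswap : ∀ i, φ (X (Equiv.swap a b i)) = rename (Equiv.swap c d) (φ (X i)))
    (f : MvPolynomial σ ℤ) : e * φ (divDiff a b f) = divDiff c d (φ f) := by
  have hcomp : ∀ g, φ (rename (Equiv.swap a b) g) = rename (Equiv.swap c d) (φ g) := by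
    intro g
    have : φ.comp (rename (Equiv.swap a b)) = (rename (Equiv.swap c d)).comp φ :=
      algHom_ext fun i => by simpa using hswap i
    exact DFunLike.congr_fun this g
  symm
  refine divDiff_eq_of_mul_eq h ?_
  have := congrArg φ (sub_mul_divDiff a b f)
  rw [map_mul, map_sub, hsub, map_sub, hcomp] at this
  linear_combination this

/-- The case `e = 1` covers transpositions of other variables, `y = 0`, the index shift and the
inclusion of the `x` variables; only `x = -y` needs `e = -1`. -/
theorem algHom_divDiff {a b : σ} {c d : τ} (h : c ≠ d)
    (φ : MvPolynomial σ ℤ →ₐ[ℤ] MvPolynomial τ ℤ)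
    (hsub : φ (X a) - φ (X b) = X c - X d)
    (hswap : ∀ i, φ (X (Equiv.swap a b i)) = rename (Equiv.swap c d) (φ (X i)))
    (f : MvPolynomial σ ℤ) : φ (divDiff a b f) = divDiff c d (φ f) := by
  rw [← mul_algHom_divDiff h φ 1 (by rw [one_mul, hsub]) hswap, one_mul]

theorem divDiff_neg {a b : σ} (h : a ≠ b) (f : MvPolynomial σ ℤ) :
    divDiff a b (-f) = -divDiff a b f :=
  divDiff_eq_of_mul_eq h (by rw [mul_neg, sub_mul_divDiff, map_neg]; ring)

theorem divDiff_zero {a b : σ} (h : a ≠ b) : divDiff a b (0 : MvPolynomial σ ℤ) = 0 :=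
  (divDiff_eq_zero_iff h).2 (map_zero _)

theorem divDiff_comm {a b c d : σ} (hab : a ≠ b) (hcd : c ≠ d) (hac : a ≠ c) (had : a ≠ d)
    (hbc : b ≠ c) (hbd : b ≠ d) (f : MvPolynomial σ ℤ) :
    divDiff a b (divDiff c d f) = divDiff c d (divDiff a b f) := by
  refine divDiff_eq_of_mul_eq hab ?_
  have key : rename (Equiv.swap a b) (divDiff c d f) =
      divDiff c d (rename (Equiv.swap a b) f) := by
    refine algHom_divDiff hcd (rename (Equiv.swap a b)) ?_ (fun i => ?_) f
    · simp only [rename_X, Equiv.swap_apply_of_ne_of_ne hac.symm hbc.symm,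
        Equiv.swap_apply_of_ne_of_ne had.symm hbd.symm]
    · simp only [rename_X]
      congr 1
      simp only [Equiv.swap_apply_def]
      grind
  have hsym : rename (Equiv.swap c d) (X a - X b : MvPolynomial σ ℤ) = X a - X b := by
    simp only [map_sub, rename_X, Equiv.swap_apply_of_ne_of_ne hac had,
      Equiv.swap_apply_of_ne_of_ne hbc hbd]
  rw [key, mul_comm, ← divDiff_mul_of_rename_eq hcd hsym, mul_comm, sub_mul_divDiff, sub_eq_add_neg,
    divDiff_add hcd, divDiff_neg hcd, ← sub_eq_add_neg]

/-- With denominators cleared, the triple divided difference is the antisymmetrization over the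
permutations of `a`, `b`, `c`. It does not depend on which reduced word of the longest one is used,
whence the braid relation. -/
theorem mul_divDiff_braid {a b c : σ} (hab : a ≠ b) (hac : a ≠ c) (hbc : b ≠ c)
    (f : MvPolynomial σ ℤ) :
    (X a - X b) * (X a - X c) * (X b - X c) * divDiff a b (divDiff b c (divDiff a b f)) =
      f - rename (Equiv.swap a b) f - rename (Equiv.swap b c) f +
        rename (Equiv.swap b c) (rename (Equiv.swap a b) f) +
        rename (Equiv.swap a b) (rename (Equiv.swap b c) f) -
        rename (Equiv.swap a b) (rename (Equiv.swap b c) (rename (Equiv.swap a b) f)) := by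
  have hk := sub_mul_divDiff a b (divDiff b c (divDiff a b f))
  have hh := sub_mul_divDiff b c (divDiff a b f)
  have hg := sub_mul_divDiff a b f
  have hs := rename_divDiff_self hab f
  have hsh := congrArg (rename (Equiv.swap a b)) hh
  have htg := congrArg (rename (Equiv.swap b c)) hg
  have hstg := congrArg (rename (Equiv.swap a b)) htg
  simp only [map_mul, map_sub, rename_X, Equiv.swap_apply_left, Equiv.swap_apply_right,
    Equiv.swap_apply_of_ne_of_ne hab hac, Equiv.swap_apply_of_ne_of_ne hac.symm hbc.symm, hs]
    at hsh htg hstg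
  linear_combination (X a - X c) * (X b - X c) * hk + (X a - X c) * hh - (X b - X c) * hsh + hg
    - htg + hstg

theorem divDiff_braid {a b c : σ} (hab : a ≠ b) (hac : a ≠ c) (hbc : b ≠ c)
    (f : MvPolynomial σ ℤ) :
    divDiff a b (divDiff b c (divDiff a b f)) = divDiff b c (divDiff a b (divDiff b c f)) := by
  have h1 := mul_divDiff_braid hab hac hbc f
  have hsw : ∀ (p q : σ) (g : MvPolynomial σ ℤ), p ≠ q → divDiff p q g = -divDiff q p g := by
    intro p q g hpq
    refine divDiff_eq_of_mul_eq hpq ?_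
    rw [Equiv.swap_comm, ← sub_mul_divDiff q p g]
    ring
  -- The triple `c, b, a` gives the other composite, up to the sign from reversing each of the three
  -- pairs of variables.
  have h2 := mul_divDiff_braid hbc.symm hac.symm hab.symm f
  rw [hsw c b f hbc.symm, hsw b a _ hab.symm, hsw c b _ hbc.symm, divDiff_neg hab, neg_neg,
    Equiv.swap_comm c b, Equiv.swap_comm b a] at h2
  have h3 : rename (Equiv.swap a b) (rename (Equiv.swap b c) (rename (Equiv.swap a b) f)) =
      rename (Equiv.swap b c) (rename (Equiv.swap a b) (rename (Equiv.swap b c) f)) := by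
    simp only [rename_rename]
    congr 2
    funext i
    simp only [Function.comp_apply, Equiv.swap_apply_def]
    grind
  have hne := mul_ne_zero (mul_ne_zero (X_sub_X_ne_zero hab) (X_sub_X_ne_zero hac))
    (X_sub_X_ne_zero hbc)
  refine mul_left_cancel₀ hne (h1.trans ?_)
  rw [h3]
  linear_combination -h2

/-- Multiplication by `X a - X b` is injective and raises the degree of each homogeneous component
by one. For `n = 0` every component vanishes, so the truncated `n - 1` is harmless. -/
theorem divDiff_isHomogeneous {a b : σ} (h : a ≠ b) {f : MvPolynomial σ ℤ} {n : ℕ}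
    (hf : f.IsHomogeneous n) : (divDiff a b f).IsHomogeneous (n - 1) := by
  have hL : (X a - X b : MvPolynomial σ ℤ).IsHomogeneous 1 :=
    (isHomogeneous_X ℤ a).sub (isHomogeneous_X ℤ b)
  set g := divDiff a b f with hg
  have hLg : ((X a - X b) * g).IsHomogeneous n := by
    rw [hg, sub_mul_divDiff]
    exact hf.sub hf.rename_isHomogeneous
  have hcomp : ∀ m, homogeneousComponent (m + 1) ((X a - X b) * g) =
      (X a - X b) * homogeneousComponent m g := by
    intro m
    conv_lhs => rw [← sum_homogeneousComponent g, Finset.mul_sum, map_sum]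
    have : ∀ i, homogeneousComponent (m + 1) ((X a - X b) * homogeneousComponent i g) =
        if m = i then (X a - X b) * homogeneousComponent i g else 0 := by
      intro i
      rw [homogeneousComponent_of_mem (n := 1 + i)
        (hL.mul (homogeneousComponent_isHomogeneous i g))]
      simp only [show (m + 1 = 1 + i) ↔ m = i by omega]
    simp only [this, Finset.sum_ite_eq]
    split_ifs with hm
    · rfl
    · rw [homogeneousComponent_eq_zero m g (by simpa using hm), mul_zero]
  have hzero : ∀ m, m + 1 ≠ n → homogeneousComponent m g = 0 := by
    intro m hm
    have := hcomp m
    rw [homogeneousComponent_of_mem hLg, if_neg hm] at this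
    exact (mul_eq_zero.1 this.symm).resolve_left (X_sub_X_ne_zero h)
  rw [← sum_homogeneousComponent g]
  refine IsHomogeneous.sum _ _ _ fun i _ => ?_
  by_cases hi : i + 1 = n
  · have : i = n - 1 := by omega
    exact this ▸ homogeneousComponent_isHomogeneous i g
  · rw [hzero i hi]
    exact isHomogeneous_zero _ _ _

/-- Total degrees add in a domain. This strict drop drives the inductions on degree. -/
theorem totalDegree_divDiff_lt {a b : σ} (h : a ≠ b) {f : MvPolynomial σ ℤ}
    (h0 : divDiff a b f ≠ 0) : (divDiff a b f).totalDegree + 1 ≤ f.totalDegree := by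
  have hL : (X a - X b : MvPolynomial σ ℤ).totalDegree = 1 :=
    ((isHomogeneous_X ℤ a).sub (isHomogeneous_X ℤ b)).totalDegree (X_sub_X_ne_zero h)
  have := totalDegree_mul_of_isDomain (X_sub_X_ne_zero h) h0
  rw [sub_mul_divDiff, hL] at this
  have h1 := totalDegree_sub f (rename (Equiv.swap a b) f)
  have h2 := totalDegree_rename_le (Equiv.swap a b) f
  have h3 := max_le le_rfl h2
  omega

end DividedDifferenceLemmas

/-! ### The operators `∂_w` -/

section DivDiffPerm

open FinPerm

variable {σ : Type} [DecidableEq σ] {x : ℕ → σ}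

/-- The composition of divided differences along a word. -/
noncomputable def divDiffWord (x : ℕ → σ) (a : List ℕ) (f : MvPolynomial σ ℤ) :
    MvPolynomial σ ℤ :=
  a.foldr (fun i g => divDiff (x i) (x (i + 1)) g) f

theorem divDiffWord_append (a b : List ℕ) (f : MvPolynomial σ ℤ) :
    divDiffWord x (a ++ b) f = divDiffWord x a (divDiffWord x b f) :=
  List.foldr_append

theorem divDiffWord_pair_eq (hx : Function.Injective x) {i j : ℕ}
    (h : i + 1 < j) (f : MvPolynomial σ ℤ) :
    divDiffWord x [i, j] f = divDiffWord x [j, i] f :=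
  divDiff_comm (hx.ne (by omega)) (hx.ne (by omega)) (hx.ne (by omega)) (hx.ne (by omega))
    (hx.ne (by omega)) (hx.ne (by omega)) f

theorem divDiffWord_braid (hx : Function.Injective x) (i : ℕ) (f : MvPolynomial σ ℤ) :
    divDiffWord x [i, i + 1, i] f = divDiffWord x [i + 1, i, i + 1] f :=
  divDiff_braid (hx.ne (by omega)) (hx.ne (by omega)) (hx.ne (by omega)) f

/-- Two reduced words of the same permutation give the same operator. -/
theorem divDiffWord_eq (hx : Function.Injective x) {w : FinPerm} {a b : List ℕ}
    (ha : IsReducedWord a w) (hb : IsReducedWord b w) (f : MvPolynomial σ ℤ) :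
    divDiffWord x a f = divDiffWord x b f := by
  induction hl : length w using Nat.strong_induction_on generalizing w a b f with
  | _ l ih =>
    rcases List.eq_nil_or_concat a with rfl | ⟨a, i, rfl⟩
    · have : b = [] := List.length_eq_zero_iff.1 (hb.2.trans ha.2.symm)
      rw [this]
    rcases List.eq_nil_or_concat b with rfl | ⟨b, j, rfl⟩
    · have := ha.2.trans hb.2.symm
      simp at this
    rw [List.concat_eq_append] at ha hb ⊢
    rw [List.concat_eq_append]
    -- by symmetry, the last letters may be taken to satisfy `i < j`
    have main : ∀ (i j : ℕ) (a b : List ℕ), i < j → IsReducedWord (a ++ [i]) w →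
        IsReducedWord (b ++ [j]) w → divDiffWord x (a ++ [i]) f = divDiffWord x (b ++ [j]) f := by
      intro i j a b hij ha hb
      obtain ⟨hdi, ha'⟩ := ha.of_append
      obtain ⟨hdj, hb'⟩ := hb.of_append
      have hli := length_mul_simple w i hdi
      have hlj := length_mul_simple w j hdj
      rcases Nat.lt_or_ge (i + 1) j with hfar | hnear
      -- Distant descents can be removed one after the other: both words are compared, by induction,
      -- with `c ++ [j, i]` and `c ++ [i, j]`.
      · have e1 : (w * simple i).1 (j + 1) < (w * simple i).1 j := by
          rwa [mul_simple_apply_of_ne w (by omega) (by omega),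
            mul_simple_apply_of_ne w (by omega) (by omega)]
        have hlij := length_mul_simple _ _ e1
        obtain ⟨c, hc⟩ := exists_isReducedWord (w * simple i * simple j)
        have hc1 : IsReducedWord (c ++ [j]) (w * simple i) :=
          ⟨by simp [hc.1, mul_simple_mul_simple], by simp [hc.2]; omega⟩
        have hc2 : IsReducedWord (c ++ [i]) (w * simple j) := by
          refine ⟨?_, by simp [hc.2]; omega⟩
          simp only [List.map_append, List.prod_append, hc.1, List.map_cons, List.map_nil,
            List.prod_singleton]
          rw [mul_assoc w, simple_commute hfar, ← mul_assoc, mul_simple_mul_simple]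
        rw [divDiffWord_append, divDiffWord_append, ih _ (by omega) ha' hc1 _ rfl,
          ih _ (by omega) hb' hc2 _ rfl, divDiffWord_append, divDiffWord_append]
        exact congrArg _ (divDiffWord_pair_eq hx hfar f).symm
      -- Adjacent descents mean that three consecutive values decrease, so `w` ends in the longest
      -- element on three letters; compare with `c ++ [i, i + 1, i]` and `c ++ [i + 1, i, i + 1]`.
      · obtain rfl : j = i + 1 := by omega
        have e1 : (w * simple i).1 (i + 1 + 1) < (w * simple i).1 (i + 1) := by
          rw [mul_simple_apply_right, mul_simple_apply_of_ne w (by omega) (by omega)]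
          omega
        have hl1 := length_mul_simple _ _ e1
        have e2 : (w * simple i * simple (i + 1)).1 (i + 1) <
            (w * simple i * simple (i + 1)).1 i := by
          rw [mul_simple_apply_left, mul_simple_apply_of_ne (w * simple i) (by omega) (by omega),
            mul_simple_apply_left, mul_simple_apply_of_ne w (by omega) (by omega)]
          exact hdj
        have hl2 := length_mul_simple _ _ e2
        obtain ⟨c, hc⟩ := exists_isReducedWord (w * simple i * simple (i + 1) * simple i)
        have hc1 : IsReducedWord (c ++ [i, i + 1]) (w * simple i) := by
          refine ⟨?_, by simp [hc.2]; omega⟩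
          simp only [List.map_append, List.prod_append, hc.1, List.map_cons, List.map_nil,
            List.prod_cons, List.prod_nil, mul_one]
          rw [← mul_assoc, mul_simple_mul_simple, mul_simple_mul_simple]
        have hc2 : IsReducedWord (c ++ [i + 1, i]) (w * simple (i + 1)) := by
          refine ⟨?_, by simp [hc.2]; omega⟩
          simp only [List.map_append, List.prod_append, hc.1, List.map_cons, List.map_nil,
            List.prod_cons, List.prod_nil, mul_one]
          rw [mul_assoc (w * simple i), mul_assoc w, ← mul_assoc (simple i), simple_braid,
            ← mul_assoc, ← mul_assoc, ← mul_assoc, mul_simple_mul_simple, mul_simple_mul_simple]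
        rw [divDiffWord_append, divDiffWord_append, ih _ (by omega) ha' hc1 _ rfl,
          ih _ (by omega) hb' hc2 _ rfl, divDiffWord_append, divDiffWord_append]
        exact congrArg _ (divDiffWord_braid hx i f)
    rcases lt_trichotomy i j with hij | rfl | hij
    · exact main i j a b hij ha hb
    · have hli := length_mul_simple w i ha.of_append.1
      rw [divDiffWord_append, divDiffWord_append]
      exact ih _ (by omega) ha.of_append.2 hb.of_append.2 _ rfl
    · exact (main j i b a hij hb ha).symm

theorem divDiffPerm_eq_divDiffWord (hx : Function.Injective x) {w : FinPerm} {a : List ℕ}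
    (ha : IsReducedWord a w) (f : MvPolynomial σ ℤ) :
    divDiffPerm x w f = divDiffWord x a f :=
  divDiffWord_eq hx (exists_isReducedWord w).choose_spec ha f

theorem divDiffPerm_one (hx : Function.Injective x) (f : MvPolynomial σ ℤ) :
    divDiffPerm x 1 f = f :=
  divDiffPerm_eq_divDiffWord hx isReducedWord_one f

theorem divDiffPerm_mul_simple (hx : Function.Injective x) {w : FinPerm} {i : ℕ}
    (h : w.1 i < w.1 (i + 1)) (f : MvPolynomial σ ℤ) :
    divDiffPerm x (w * simple i) f = divDiffPerm x w (divDiff (x i) (x (i + 1)) f) := by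
  obtain ⟨a, ha⟩ := exists_isReducedWord w
  rw [divDiffPerm_eq_divDiffWord hx ha, divDiffPerm_eq_divDiffWord hx (ha.append h),
    divDiffWord_append]
  rfl

theorem divDiffPerm_of_descent (hx : Function.Injective x) {w : FinPerm} {i : ℕ}
    (h : w.1 (i + 1) < w.1 i) (f : MvPolynomial σ ℤ) :
    divDiffPerm x w f = divDiffPerm x (w * simple i) (divDiff (x i) (x (i + 1)) f) := by
  rw [← divDiffPerm_mul_simple hx, mul_simple_mul_simple]
  rwa [mul_simple_apply_left, mul_simple_apply_right]

theorem divDiffPerm_simple_mul (hx : Function.Injective x) {w : FinPerm} {i : ℕ}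
    (h : (w⁻¹).1 i < (w⁻¹).1 (i + 1)) (f : MvPolynomial σ ℤ) :
    divDiffPerm x (simple i * w) f = divDiff (x i) (x (i + 1)) (divDiffPerm x w f) := by
  obtain ⟨a, ha⟩ := exists_isReducedWord w
  rw [divDiffPerm_eq_divDiffWord hx ha, divDiffPerm_eq_divDiffWord hx (ha.cons h)]
  rfl

/-- A left descent lets a reduced word of `w` begin with `i`, and `∂_i ∂_i = 0`. -/
theorem divDiff_divDiffPerm_eq_zero (hx : Function.Injective x) {w : FinPerm} {i : ℕ}
    (h : (w⁻¹).1 (i + 1) < (w⁻¹).1 i) (f : MvPolynomial σ ℤ) :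
    divDiff (x i) (x (i + 1)) (divDiffPerm x w f) = 0 := by
  have h' : ((simple i * w)⁻¹).1 i < ((simple i * w)⁻¹).1 (i + 1) := by
    rwa [mul_inv_rev, simple_inv, mul_simple_apply_left, mul_simple_apply_right]
  have := divDiffPerm_simple_mul hx h' f
  rw [← mul_assoc, simple_mul_simple, one_mul] at this
  rw [this, divDiff_divDiff_self (hx.ne (by omega))]

theorem divDiffPerm_add (hx : Function.Injective x) (w : FinPerm) (f g : MvPolynomial σ ℤ) :
    divDiffPerm x w (f + g) = divDiffPerm x w f + divDiffPerm x w g := by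
  induction w using descent_induction generalizing f g with
  | one => simp only [divDiffPerm_one hx]
  | descent w i hi ih =>
    simp only [divDiffPerm_of_descent hx hi, divDiff_add (hx.ne (Nat.ne_of_lt (Nat.lt_succ_self i))),
      ih]

theorem divDiffPerm_zero (hx : Function.Injective x) (w : FinPerm) :
    divDiffPerm x w (0 : MvPolynomial σ ℤ) = 0 := by
  have := divDiffPerm_add hx w (0 : MvPolynomial σ ℤ) 0
  simpa using this

theorem divDiffPerm_neg (hx : Function.Injective x) (w : FinPerm) (f : MvPolynomial σ ℤ) :
    divDiffPerm x w (-f) = -divDiffPerm x w f := by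
  have := divDiffPerm_add hx w f (-f)
  rw [add_neg_cancel, divDiffPerm_zero hx] at this
  exact eq_neg_of_add_eq_zero_right this.symm

/-- `∂_w` is linear over polynomials that are invariant under all adjacent transpositions. -/
theorem divDiffPerm_mul_of_rename_eq (hx : Function.Injective x) {g : MvPolynomial σ ℤ}
    (hg : ∀ i, rename (Equiv.swap (x i) (x (i + 1))) g = g) (w : FinPerm)
    (f : MvPolynomial σ ℤ) : divDiffPerm x w (f * g) = divDiffPerm x w f * g := by
  induction w using descent_induction generalizing f with
  | one => simp only [divDiffPerm_one hx]
  | descent w i hi ih =>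
    simp only [divDiffPerm_of_descent hx hi,
      divDiff_mul_of_rename_eq (hx.ne (Nat.ne_of_lt (Nat.lt_succ_self i))) (hg i), ih]

theorem divDiff_divDiffPerm_comm (hx : Function.Injective x) {a b : σ} (hab : a ≠ b)
    (ha : ∀ i, a ≠ x i) (hb : ∀ i, b ≠ x i) (w : FinPerm) (f : MvPolynomial σ ℤ) :
    divDiff a b (divDiffPerm x w f) = divDiffPerm x w (divDiff a b f) := by
  induction w using descent_induction generalizing f with
  | one => simp only [divDiffPerm_one hx]
  | descent w i hi ih =>
    rw [divDiffPerm_of_descent hx hi, ih, divDiffPerm_of_descent hx hi,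
      divDiff_comm hab (hx.ne (by omega)) (ha _) (ha _) (hb _) (hb _)]

theorem divDiffPerm_isHomogeneous (hx : Function.Injective x) (w : FinPerm) {n : ℕ}
    {f : MvPolynomial σ ℤ} (hf : f.IsHomogeneous n) :
    ∃ m, (divDiffPerm x w f).IsHomogeneous m := by
  induction w using descent_induction generalizing f n with
  | one => exact ⟨n, by rwa [divDiffPerm_one hx]⟩
  | descent w i hi ih =>
    rw [divDiffPerm_of_descent hx hi]
    exact ih (divDiff_isHomogeneous (hx.ne (by omega)) hf)

theorem divDiffPerm_eq_zero_of_totalDegree_lt (hx : Function.Injective x) {w : FinPerm}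
    {f : MvPolynomial σ ℤ} (h : f.totalDegree < length w) : divDiffPerm x w f = 0 := by
  induction w using descent_induction generalizing f with
  | one => simp at h
  | descent w i hi ih =>
    rw [divDiffPerm_of_descent hx hi]
    by_cases h0 : divDiff (x i) (x (i + 1)) f = 0
    · rw [h0, divDiffPerm_zero hx]
    · have := totalDegree_divDiff_lt (hx.ne (by omega)) h0
      have := length_mul_simple w i hi
      exact ih (by omega)

/-- A polynomial killed by all divided differences in the variables `x` does not involve them. -/
theorem notMem_vars_of_divDiff_eq_zero (hx : Function.Injective x) {f : MvPolynomial σ ℤ}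
    (h : ∀ i, divDiff (x i) (x (i + 1)) f = 0) (i : ℕ) : x i ∉ f.vars := by
  intro hi
  -- Invariance under each adjacent swap carries a variable along the whole sequence, which would
  -- make the finite set `f.vars` infinite.
  have step : ∀ j, x j ∈ f.vars → x (j + 1) ∈ f.vars := by
    intro j hj
    have hs := (divDiff_eq_zero_iff (hx.ne (by omega))).1 (h j)
    rw [← hs] at hj
    obtain ⟨c, hc, hcj⟩ := mem_vars_rename _ _ hj
    have : c = x (j + 1) := by
      rw [← Equiv.swap_apply_left (x j) (x (j + 1)), ← (Equiv.swap_apply_eq_iff.1 hcj)]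
    exact this ▸ hc
  have all : ∀ j, x (i + j) ∈ f.vars := by
    intro j
    induction j with
    | zero => exact hi
    | succ j ih => exact step _ ih
  have hinj : Function.Injective fun j => x (i + j) := fun a b hab => by
    have := hx hab
    omega
  exact Set.infinite_range_of_injective hinj
    (f.vars.finite_toSet.subset (by rintro _ ⟨j, rfl⟩; exact all j))

/-- The uniqueness principle: a polynomial is determined by its divided differences and its constant
term. -/
theorem eq_C_of_divDiff_eq_zero {f : MvPolynomial ℕ ℤ} (h : ∀ i, divDiff i (i + 1) f = 0) :
    f = C (constantCoeff f) :=
  vars_eq_empty_iff_eq_C.1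
    (Finset.eq_empty_of_forall_notMem
      (notMem_vars_of_divDiff_eq_zero (x := id) Function.injective_id h))

theorem eq_C_of_divDiff_inl_eq_zero_of_divDiff_inr_eq_zero {f : MvPolynomial (ℕ ⊕ ℕ) ℤ}
    (hl : ∀ i, divDiff (Sum.inl i) (Sum.inl (i + 1)) f = 0)
    (hr : ∀ j, divDiff (Sum.inr j) (Sum.inr (j + 1)) f = 0) :
    f = C (constantCoeff f) := by
  refine vars_eq_empty_iff_eq_C.1 (Finset.eq_empty_of_forall_notMem ?_)
  rintro (i | j)
  · exact notMem_vars_of_divDiff_eq_zero Sum.inl_injective hl i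
  · exact notMem_vars_of_divDiff_eq_zero Sum.inr_injective hr j

end DivDiffPerm

/-! ### Products of `x_i - y_j` over staircases -/

section BoxProducts

open FinPerm

/-- The product of `x_i - y_j` over a finite set of boxes `(i, j)`. -/
noncomputable def boxProd (S : Finset (ℕ × ℕ)) : MvPolynomial (ℕ ⊕ ℕ) ℤ :=
  ∏ p ∈ S, (X (Sum.inl p.1) - X (Sum.inr p.2))

theorem swap_inl_inl (a b c : ℕ) :
    Equiv.swap (Sum.inl a : ℕ ⊕ ℕ) (Sum.inl b) (Sum.inl c) = Sum.inl (Equiv.swap a b c) :=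
  Sum.inl_injective.swap_apply a b c

theorem swap_inr_inr (a b c : ℕ) :
    Equiv.swap (Sum.inr a : ℕ ⊕ ℕ) (Sum.inr b) (Sum.inr c) = Sum.inr (Equiv.swap a b c) :=
  Sum.inr_injective.swap_apply a b c

theorem swap_inl_inr (a b c : ℕ) :
    Equiv.swap (Sum.inl a : ℕ ⊕ ℕ) (Sum.inl b) (Sum.inr c) = Sum.inr c :=
  Equiv.swap_apply_of_ne_of_ne Sum.inr_ne_inl Sum.inr_ne_inl

theorem swap_inr_inl (a b c : ℕ) :
    Equiv.swap (Sum.inr a : ℕ ⊕ ℕ) (Sum.inr b) (Sum.inl c) = Sum.inl c :=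
  Equiv.swap_apply_of_ne_of_ne Sum.inl_ne_inr Sum.inl_ne_inr

theorem inl_ne_inl_succ (i : ℕ) : (Sum.inl i : ℕ ⊕ ℕ) ≠ Sum.inl (i + 1) := by simp

theorem inr_ne_inr_succ (i : ℕ) : (Sum.inr i : ℕ ⊕ ℕ) ≠ Sum.inr (i + 1) := by simp

theorem rename_swap_inl_boxProd {S : Finset (ℕ × ℕ)} {a : ℕ}
    (h : ∀ i j, (Equiv.swap a (a + 1) i, j) ∈ S ↔ (i, j) ∈ S) :
    rename (Equiv.swap (Sum.inl a : ℕ ⊕ ℕ) (Sum.inl (a + 1))) (boxProd S) = boxProd S := by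
  rw [boxProd, map_prod]
  refine Finset.prod_equiv ((Equiv.swap a (a + 1)).prodCongr (Equiv.refl ℕ))
    (fun p => (h p.1 p.2).symm) fun p _ => ?_
  simp [rename_X, swap_inl_inl, swap_inl_inr]

theorem rename_swap_inr_boxProd {S : Finset (ℕ × ℕ)} {b : ℕ}
    (h : ∀ i j, (i, Equiv.swap b (b + 1) j) ∈ S ↔ (i, j) ∈ S) :
    rename (Equiv.swap (Sum.inr b : ℕ ⊕ ℕ) (Sum.inr (b + 1))) (boxProd S) = boxProd S := by
  rw [boxProd, map_prod]
  refine Finset.prod_equiv ((Equiv.refl ℕ).prodCongr (Equiv.swap b (b + 1)))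
    (fun p => (h p.1 p.2).symm) fun p _ => ?_
  simp [rename_X, swap_inr_inr, swap_inr_inl]

theorem divDiff_inl_boxProd_insert {S : Finset (ℕ × ℕ)} {a b : ℕ} (hab : (a, b) ∉ S)
    (h : ∀ i j, (Equiv.swap a (a + 1) i, j) ∈ S ↔ (i, j) ∈ S) :
    divDiff (Sum.inl a) (Sum.inl (a + 1)) (boxProd (insert (a, b) S)) = boxProd S := by
  refine divDiff_eq_of_mul_eq (inl_ne_inl_succ a) ?_
  have : boxProd (insert (a, b) S) = (X (Sum.inl a) - X (Sum.inr b)) * boxProd S :=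
    Finset.prod_insert hab
  rw [this, map_mul, rename_swap_inl_boxProd h, map_sub, rename_X, rename_X, swap_inl_inr,
    Equiv.swap_apply_left]
  ring

theorem divDiff_inr_boxProd_insert {S : Finset (ℕ × ℕ)} {a b : ℕ} (hab : (a, b) ∉ S)
    (h : ∀ i j, (i, Equiv.swap b (b + 1) j) ∈ S ↔ (i, j) ∈ S) :
    divDiff (Sum.inr b) (Sum.inr (b + 1)) (boxProd (insert (a, b) S)) = -boxProd S := by
  refine divDiff_eq_of_mul_eq (inr_ne_inr_succ b) ?_
  have : boxProd (insert (a, b) S) = (X (Sum.inl a) - X (Sum.inr b)) * boxProd S :=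
    Finset.prod_insert hab
  rw [this, map_mul, rename_swap_inr_boxProd h, map_sub, rename_X, rename_X, swap_inr_inl,
    Equiv.swap_apply_left]
  ring

theorem boxProd_isHomogeneous (S : Finset (ℕ × ℕ)) : (boxProd S).IsHomogeneous (∑ _p ∈ S, 1) :=
  IsHomogeneous.prod S _ _ fun _ _ => (isHomogeneous_X ℤ _).sub (isHomogeneous_X ℤ _)

/-- The boxes of the staircase with rows of lengths `N, N - 1, …, 1`, where the first `m` rows are
shortened by one box. -/
def staircase (N m : ℕ) : Finset (ℕ × ℕ) :=
  (Finset.range N ×ˢ Finset.range N).filter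
    fun p => (p.1 < m ∧ p.1 + p.2 + 1 < N) ∨ (m ≤ p.1 ∧ p.1 + p.2 < N)

theorem mem_staircase {N m i j : ℕ} :
    (i, j) ∈ staircase N m ↔ (i < m ∧ i + j + 1 < N) ∨ (m ≤ i ∧ i + j < N) := by
  simp only [staircase, Finset.mem_filter, Finset.mem_product, Finset.mem_range]
  omega

theorem staircase_eq_insert {N m : ℕ} (h : m < N) :
    staircase N m = insert (m, N - 1 - m) (staircase N (m + 1)) := by
  ext ⟨i, j⟩
  simp only [Finset.mem_insert, mem_staircase, Prod.mk.injEq]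
  omega

theorem staircase_zero (N : ℕ) : staircase N 0 = staircase (N + 1) (N + 1) := by
  ext ⟨i, j⟩
  simp only [mem_staircase]
  omega

/-- Rows `m` and `m + 1` of the smaller staircase have equal length, so its product is symmetric;
the last box of row `m` is the only asymmetric factor. -/
theorem divDiff_boxProd_staircase {N m : ℕ} (h : m < N) :
    divDiff (Sum.inl m) (Sum.inl (m + 1)) (boxProd (staircase N m)) =
      boxProd (staircase N (m + 1)) := by
  rw [staircase_eq_insert h, divDiff_inl_boxProd_insert]
  · simp only [mem_staircase]
    omega
  · intro i j
    simp only [mem_staircase, Equiv.swap_apply_def]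
    grind

/-- On the staircase product the divided differences in `x` and in `y` agree up to sign. -/
theorem divDiff_inr_boxProd_staircase {N j : ℕ} (h : j + 1 < N) :
    divDiff (Sum.inr j) (Sum.inr (j + 1)) (boxProd (staircase N N)) =
      -divDiff (Sum.inl (N - 2 - j)) (Sum.inl (N - 2 - j + 1)) (boxProd (staircase N N)) := by
  -- This box is a corner. Without it, rows `N - 2 - j` and `N - 1 - j` agree, and so do columns `j`
  -- and `j + 1`.
  have hmem : (N - 2 - j, j) ∈ staircase N N := mem_staircase.2 (by omega)
  rw [← Finset.insert_erase hmem, divDiff_inr_boxProd_insert (Finset.notMem_erase _ _),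
    divDiff_inl_boxProd_insert (Finset.notMem_erase _ _)]
  all_goals
    intro i k
    simp only [Finset.mem_erase, mem_staircase, Equiv.swap_apply_def, ne_eq, Prod.mk.injEq]
    grind

end BoxProducts

/-! ### From the longest element of `S_N` to that of `S_{N+1}` -/

namespace FinPerm

/-- The cycle `s_{N-1} s_{N-2} ⋯ s_{N-k}`. -/
def descendingCycle (N : ℕ) : ℕ → FinPerm
  | 0 => 1
  | k + 1 => descendingCycle N k * simple (N - 1 - k)

theorem descendingCycle_apply {N k : ℕ} (h : k ≤ N) (j : ℕ) :
    (descendingCycle N k).1 j =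
      if j < N - k then j else if j = N - k then N else if j ≤ N then j - 1 else j := by
  induction k generalizing j with
  | zero =>
    rw [descendingCycle, coe_one_apply]
    grind
  | succ k ih =>
    rw [descendingCycle, coe_mul_apply, simple_apply, ih (by omega), Equiv.swap_apply_def]
    grind

theorem longest_mul_descendingCycle (N : ℕ) :
    longest N * descendingCycle N N = longest (N + 1) :=
  ext_apply fun j => by
    rw [coe_mul_apply, descendingCycle_apply le_rfl, longest_apply, longest_apply]
    grind

theorem apply_lt_of_lt {w : FinPerm} {N : ℕ} (h : ∀ i, N ≤ i → w.1 i = i) {i : ℕ} (hi : i < N) :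
    w.1 i < N := by
  by_contra hle
  have := w.1.injective (h (w.1 i) (by omega))
  omega

end FinPerm

/-! ### Divided differences of double Schubert polynomials -/

section DoubleSchubert

open FinPerm

/-- Each letter of the cycle strips one box from one row; after `N` letters the staircase of
`S_{N+1}` has become that of `S_N`. -/
theorem divDiffPerm_mul_descendingCycle {v : FinPerm} {N k : ℕ} (hv : ∀ i, N ≤ i → v.1 i = i)
    (hk : k ≤ N) :
    divDiffPerm Sum.inl (v * descendingCycle N k) (boxProd (staircase N (N - k))) =
      divDiffPerm Sum.inl v (boxProd (staircase N N)) := by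
  induction k with
  | zero => rw [descendingCycle, mul_one, Nat.sub_zero]
  | succ k ih =>
    -- Position `N - k` holds the value `N`, while its left neighbour holds a value of `v` below
    -- `N`; so the next letter increases the length.
    have hlt : (v * descendingCycle N k).1 (N - 1 - k) <
        (v * descendingCycle N k).1 (N - 1 - k + 1) := by
      have h1 := apply_lt_of_lt hv (show N - 1 - k < N by omega)
      rw [coe_mul_apply, coe_mul_apply, descendingCycle_apply (by omega),
        descendingCycle_apply (by omega), if_pos (by omega), if_neg (by omega),
        if_pos (by omega), hv N le_rfl]
      exact h1
    rw [descendingCycle, ← mul_assoc, divDiffPerm_mul_simple Sum.inl_injective hlt,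
      show N - (k + 1) = N - 1 - k by omega, divDiff_boxProd_staircase (by omega),
      show N - 1 - k + 1 = N - k by omega]
    exact ih (by omega)

/-- Independence of `N`. It allows `w`, `w s_i` and `s_j w` to be computed from one common
staircase. -/
theorem doubleSchubert_eq_of_bound_le {w : FinPerm} {N : ℕ} (h : bound w ≤ N) :
    doubleSchubert w = divDiffPerm Sum.inl (w⁻¹ * longest N) (boxProd (staircase N N)) := by
  induction N, h using Nat.le_induction with
  | base =>
    rw [doubleSchubert, boxProd]
    congr 1
    symm
    refine Finset.prod_finset_product _ _ _ fun ⟨i, j⟩ => ?_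
    rw [mem_staircase, Finset.mem_range, Finset.mem_range]
    omega
  | succ N hN ih =>
    have hv : ∀ i, N ≤ i → (w⁻¹ * longest N).1 i = i := by
      intro i hi
      rw [coe_mul_apply, longest_apply, if_neg (by omega)]
      exact inv_apply_eq_self (apply_of_bound_le hN hi)
    rw [ih, ← divDiffPerm_mul_descendingCycle hv le_rfl, mul_assoc, longest_mul_descendingCycle,
      Nat.sub_self, staircase_zero]

theorem bound_mul_simple_le {w : FinPerm} {i N : ℕ} (hw : bound w ≤ N) (hi : i + 2 ≤ N) :
    bound (w * simple i) ≤ N :=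
  bound_le fun j hj => by
    rw [mul_simple_apply_of_ne w (by omega) (by omega), apply_of_bound_le hw hj]

theorem bound_simple_mul_le {w : FinPerm} {i N : ℕ} (hw : bound w ≤ N) (hi : i + 2 ≤ N) :
    bound (simple i * w) ≤ N :=
  bound_le fun j hj => by
    rw [coe_mul_apply, apply_of_bound_le hw hj, simple_apply,
      Equiv.swap_apply_of_ne_of_ne (by omega) (by omega)]

theorem inv_inv_mul_longest_apply (w : FinPerm) (N i : ℕ) :
    ((w⁻¹ * longest N)⁻¹).1 i = (longest N).1 (w.1 i) := by
  rw [mul_inv_rev, longest_inv, inv_inv, coe_mul_apply]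

/-- Since `s_i w⁻¹ w₀ = (w s_i)⁻¹ w₀`, this prolongs a reduced word on the left; `w₀` reverses
values, so a descent of `w` is exactly what makes the length grow. -/
theorem divDiff_inl_doubleSchubert {w : FinPerm} {i : ℕ} (h : w.1 (i + 1) < w.1 i) :
    divDiff (Sum.inl i) (Sum.inl (i + 1)) (doubleSchubert w) = doubleSchubert (w * simple i) := by
  obtain ⟨N, hN, hi⟩ : ∃ N, bound w ≤ N ∧ i + 2 ≤ N := ⟨_, le_max_left _ _, le_max_right _ _⟩
  have hv := fun j => apply_lt_of_lt (w := w) (fun _ => apply_of_bound_le hN) (i := j)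
  rw [doubleSchubert_eq_of_bound_le hN, doubleSchubert_eq_of_bound_le (bound_mul_simple_le hN hi),
    ← divDiffPerm_simple_mul Sum.inl_injective, mul_inv_rev, simple_inv, mul_assoc]
  rw [inv_inv_mul_longest_apply, inv_inv_mul_longest_apply, longest_apply, longest_apply]
  have := hv i (by omega)
  have := hv (i + 1) (by omega)
  grind

theorem divDiff_inl_doubleSchubert_eq_zero {w : FinPerm} {i : ℕ} (h : w.1 i < w.1 (i + 1)) :
    divDiff (Sum.inl i) (Sum.inl (i + 1)) (doubleSchubert w) = 0 := by
  obtain ⟨N, hN, hi⟩ : ∃ N, bound w ≤ N ∧ i + 2 ≤ N := ⟨_, le_max_left _ _, le_max_right _ _⟩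
  have hv := fun j => apply_lt_of_lt (w := w) (fun _ => apply_of_bound_le hN) (i := j)
  rw [doubleSchubert_eq_of_bound_le hN]
  refine divDiff_divDiffPerm_eq_zero Sum.inl_injective ?_ _
  rw [inv_inv_mul_longest_apply, inv_inv_mul_longest_apply, longest_apply, longest_apply]
  have := hv i (by omega)
  have := hv (i + 1) (by omega)
  grind

/-- Operators in `y` commute with those in `x`, so the one in `y` reaches the staircase product and
is traded there for one in `x`. -/
theorem divDiff_inr_doubleSchubert_aux {w : FinPerm} {N j : ℕ} (hN : bound w ≤ N)
    (hj : j + 2 ≤ N) :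
    divDiff (Sum.inr j) (Sum.inr (j + 1)) (doubleSchubert w) =
      -divDiffPerm Sum.inl (w⁻¹ * longest N)
        (divDiff (Sum.inl (N - 2 - j)) (Sum.inl (N - 2 - j + 1)) (boxProd (staircase N N))) := by
  rw [doubleSchubert_eq_of_bound_le hN,
    divDiff_divDiffPerm_comm Sum.inl_injective (inr_ne_inr_succ j) (fun _ => Sum.inr_ne_inl)
      (fun _ => Sum.inr_ne_inl), divDiff_inr_boxProd_staircase (by omega),
    divDiffPerm_neg Sum.inl_injective]

theorem inv_mul_longest_apply_left {w : FinPerm} {N j : ℕ} (hj : j + 2 ≤ N) :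
    (w⁻¹ * longest N).1 (N - 2 - j) = (w⁻¹).1 (j + 1) := by
  rw [coe_mul_apply, longest_apply, if_pos (by omega)]
  congr 1
  omega

theorem inv_mul_longest_apply_right {w : FinPerm} {N j : ℕ} (hj : j + 2 ≤ N) :
    (w⁻¹ * longest N).1 (N - 2 - j + 1) = (w⁻¹).1 j := by
  rw [coe_mul_apply, longest_apply, if_pos (by omega)]
  congr 1
  omega

/-- The traded operator multiplies on the right: `w⁻¹ w₀ s_{N-2-j} = w⁻¹ s_j w₀ = (s_j w)⁻¹ w₀`. -/
theorem divDiff_inr_doubleSchubert {w : FinPerm} {j : ℕ} (h : (w⁻¹).1 (j + 1) < (w⁻¹).1 j) :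
    divDiff (Sum.inr j) (Sum.inr (j + 1)) (doubleSchubert w) =
      -doubleSchubert (simple j * w) := by
  obtain ⟨N, hN, hj⟩ : ∃ N, bound w ≤ N ∧ j + 2 ≤ N := ⟨_, le_max_left _ _, le_max_right _ _⟩
  rw [divDiff_inr_doubleSchubert_aux hN hj,
    doubleSchubert_eq_of_bound_le (bound_simple_mul_le hN hj), mul_inv_rev, simple_inv, mul_assoc,
    simple_mul_longest (by omega), ← mul_assoc, divDiffPerm_mul_simple Sum.inl_injective]
  rwa [inv_mul_longest_apply_left hj, inv_mul_longest_apply_right hj]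

theorem divDiff_inr_doubleSchubert_eq_zero {w : FinPerm} {j : ℕ}
    (h : (w⁻¹).1 j < (w⁻¹).1 (j + 1)) :
    divDiff (Sum.inr j) (Sum.inr (j + 1)) (doubleSchubert w) = 0 := by
  obtain ⟨N, hN, hj⟩ : ∃ N, bound w ≤ N ∧ j + 2 ≤ N := ⟨_, le_max_left _ _, le_max_right _ _⟩
  rw [divDiff_inr_doubleSchubert_aux hN hj, divDiffPerm_of_descent Sum.inl_injective
    (i := N - 2 - j), divDiff_divDiff_self (inl_ne_inl_succ _), divDiffPerm_zero Sum.inl_injective,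
    neg_zero]
  rwa [inv_mul_longest_apply_left hj, inv_mul_longest_apply_right hj]

theorem doubleSchubert_one : doubleSchubert 1 = 1 := by
  have h : longest 0 = 1 := ext_apply fun i => rfl
  rw [doubleSchubert, bound_one, h, inv_one, mul_one, divDiffPerm_one Sum.inl_injective]
  rfl

theorem doubleSchubert_ne_zero (w : FinPerm) : doubleSchubert w ≠ 0 := by
  induction w using descent_induction with
  | one => rw [doubleSchubert_one]; exact one_ne_zero
  | descent w i hi ih =>
    intro h
    rw [← divDiff_inl_doubleSchubert hi, h, divDiff_zero (inl_ne_inl_succ i)] at ih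
    exact ih rfl

theorem doubleSchubert_isHomogeneous (w : FinPerm) :
    (doubleSchubert w).IsHomogeneous (length w) := by
  induction w using descent_induction with
  | one => rw [doubleSchubert_one, length_one]; exact isHomogeneous_one _ _
  | descent w i hi ih =>
    obtain ⟨m, hm⟩ : ∃ m, (doubleSchubert w).IsHomogeneous m := by
      rw [doubleSchubert_eq_of_bound_le le_rfl]
      exact divDiffPerm_isHomogeneous Sum.inl_injective _ (boxProd_isHomogeneous _)
    have h1 := divDiff_isHomogeneous (inl_ne_inl_succ i) hm
    -- Rules out `m = 0`, where the truncated `m - 1` would break the count: a nonzero divided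
    -- difference requires positive degree.
    have h2 : 1 ≤ m := by
      by_contra hm0
      have hne : divDiff (Sum.inl i) (Sum.inl (i + 1)) (doubleSchubert w) ≠ 0 := by
        rw [divDiff_inl_doubleSchubert hi]
        exact doubleSchubert_ne_zero _
      have := totalDegree_divDiff_lt (inl_ne_inl_succ i) hne
      have := hm.totalDegree_le
      omega
    rw [divDiff_inl_doubleSchubert hi] at h1
    have h3 := ih.inj_right h1 (doubleSchubert_ne_zero _)
    have h4 := length_mul_simple w i hi
    have : length w = m := by omega
    rwa [this]

theorem length_ne_zero {w : FinPerm} (h : w ≠ 1) : length w ≠ 0 := by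
  obtain ⟨i, hi⟩ := exists_descent h
  have := length_mul_simple w i hi
  omega

theorem constantCoeff_doubleSchubert {w : FinPerm} (h : w ≠ 1) :
    constantCoeff (doubleSchubert w) = 0 := by
  rw [constantCoeff_eq]
  exact (doubleSchubert_isHomogeneous w).coeff_eq_zero
    (by rw [map_zero]; exact (length_ne_zero h).symm)

/-- The specialization `y = 0`. -/
noncomputable def setYZero : MvPolynomial (ℕ ⊕ ℕ) ℤ →ₐ[ℤ] MvPolynomial ℕ ℤ :=
  aeval (Sum.elim X 0)

theorem setYZero_divDiff (i : ℕ) (f : MvPolynomial (ℕ ⊕ ℕ) ℤ) :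
    setYZero (divDiff (Sum.inl i) (Sum.inl (i + 1)) f) = divDiff i (i + 1) (setYZero f) := by
  refine algHom_divDiff (by omega) setYZero (by simp [setYZero]) (fun j => ?_) f
  rcases j with j | j
  · simp [setYZero, swap_inl_inl, rename_X]
  · simp [setYZero, swap_inl_inr]

/-- Setting `y = 0` commutes with the operators in `x`; the facts on single Schubert polynomials are
thereby inherited from the double ones. -/
theorem schubert_eq_setYZero (w : FinPerm) : schubert w = setYZero (doubleSchubert w) := by
  have key : ∀ (v : FinPerm) (f : MvPolynomial (ℕ ⊕ ℕ) ℤ),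
      setYZero (divDiffPerm Sum.inl v f) = divDiffPerm id v (setYZero f) := by
    intro v
    induction v using descent_induction with
    | one => simp [divDiffPerm_one Sum.inl_injective, divDiffPerm_one Function.injective_id]
    | descent v i hi ih =>
      intro f
      rw [divDiffPerm_of_descent Sum.inl_injective hi, ih, setYZero_divDiff,
        divDiffPerm_of_descent Function.injective_id hi]
      rfl
  rw [schubert, doubleSchubert, key]
  simp [setYZero, map_prod, Finset.prod_const]

theorem divDiff_schubert {w : FinPerm} {i : ℕ} (h : w.1 (i + 1) < w.1 i) :
    divDiff i (i + 1) (schubert w) = schubert (w * simple i) := by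
  rw [schubert_eq_setYZero, schubert_eq_setYZero, ← setYZero_divDiff,
    divDiff_inl_doubleSchubert h]

theorem divDiff_schubert_eq_zero {w : FinPerm} {i : ℕ} (h : w.1 i < w.1 (i + 1)) :
    divDiff i (i + 1) (schubert w) = 0 := by
  rw [schubert_eq_setYZero, ← setYZero_divDiff, divDiff_inl_doubleSchubert_eq_zero h, map_zero]

theorem schubert_one : schubert 1 = 1 := by
  rw [schubert_eq_setYZero, doubleSchubert_one, map_one]

theorem constantCoeff_setYZero (f : MvPolynomial (ℕ ⊕ ℕ) ℤ) :
    constantCoeff (setYZero f) = constantCoeff f := by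
  have : (constantCoeff.comp (setYZero : _ →+* MvPolynomial ℕ ℤ)) =
      (constantCoeff : MvPolynomial (ℕ ⊕ ℕ) ℤ →+* ℤ) :=
    ringHom_ext (by simp) (by rintro (i | i) <;> simp [setYZero])
  exact DFunLike.congr_fun this f

theorem constantCoeff_schubert {w : FinPerm} (h : w ≠ 1) : constantCoeff (schubert w) = 0 := by
  rw [schubert_eq_setYZero, constantCoeff_setYZero, constantCoeff_doubleSchubert h]

end DoubleSchubert

/-! ### Setting the first variables to zero -/

section Shift

open FinPerm

/-- The sequence `0, x_0, x_1, …`. -/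
noncomputable def dropFirst {σ : Type} (x : ℕ → σ) : ℕ → MvPolynomial σ ℤ
  | 0 => 0
  | i + 1 => X (x i)

/-- The specialization `x_0 = 0`, `x_{i+1} = x_i`. -/
noncomputable def shiftVars : MvPolynomial ℕ ℤ →ₐ[ℤ] MvPolynomial ℕ ℤ :=
  aeval (dropFirst id)

/-- The specialization `x_0 = y_0 = 0`, `x_{i+1} = x_i`, `y_{i+1} = y_i`. -/
noncomputable def shiftDoubleVars : MvPolynomial (ℕ ⊕ ℕ) ℤ →ₐ[ℤ] MvPolynomial (ℕ ⊕ ℕ) ℤ :=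
  aeval (Sum.elim (dropFirst Sum.inl) (dropFirst Sum.inr))

theorem swap_succ_succ (a b c : ℕ) :
    Equiv.swap (a + 1) (b + 1) (c + 1) = Equiv.swap a b c + 1 :=
  Nat.succ_injective.swap_apply a b c

theorem swap_succ_zero (a b : ℕ) : Equiv.swap (a + 1) (b + 1) 0 = 0 :=
  Equiv.swap_apply_of_ne_of_ne (by omega) (by omega)

theorem shiftVars_divDiff (i : ℕ) (f : MvPolynomial ℕ ℤ) :
    shiftVars (divDiff (i + 1) (i + 2) f) = divDiff i (i + 1) (shiftVars f) := by
  refine algHom_divDiff (by omega) shiftVars (by simp [shiftVars, dropFirst]) (fun j => ?_) f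
  rcases j with - | j
  · simp [shiftVars, swap_succ_zero, dropFirst]
  · simp [shiftVars, swap_succ_succ, dropFirst, rename_X]

theorem shiftDoubleVars_divDiff_inl (i : ℕ) (f : MvPolynomial (ℕ ⊕ ℕ) ℤ) :
    shiftDoubleVars (divDiff (Sum.inl (i + 1)) (Sum.inl (i + 2)) f) =
      divDiff (Sum.inl i) (Sum.inl (i + 1)) (shiftDoubleVars f) := by
  refine algHom_divDiff (inl_ne_inl_succ i) shiftDoubleVars (by simp [shiftDoubleVars, dropFirst])
    (fun j => ?_) f
  rcases j with (- | j) | (- | j) <;>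
    simp [shiftDoubleVars, swap_inl_inl, swap_inl_inr, swap_succ_succ, swap_succ_zero, dropFirst,
      rename_X]

theorem shiftDoubleVars_divDiff_inr (i : ℕ) (f : MvPolynomial (ℕ ⊕ ℕ) ℤ) :
    shiftDoubleVars (divDiff (Sum.inr (i + 1)) (Sum.inr (i + 2)) f) =
      divDiff (Sum.inr i) (Sum.inr (i + 1)) (shiftDoubleVars f) := by
  refine algHom_divDiff (inr_ne_inr_succ i) shiftDoubleVars (by simp [shiftDoubleVars, dropFirst])
    (fun j => ?_) f
  rcases j with (- | j) | (- | j) <;>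
    simp [shiftDoubleVars, swap_inr_inr, swap_inr_inl, swap_succ_succ, swap_succ_zero, dropFirst,
      rename_X]

theorem constantCoeff_shiftVars (f : MvPolynomial ℕ ℤ) :
    constantCoeff (shiftVars f) = constantCoeff f := by
  have : (constantCoeff.comp (shiftVars : _ →+* MvPolynomial ℕ ℤ)) =
      (constantCoeff : MvPolynomial ℕ ℤ →+* ℤ) :=
    ringHom_ext (by simp) (by rintro (- | i) <;> simp [shiftVars, dropFirst])
  exact DFunLike.congr_fun this f

theorem constantCoeff_shiftDoubleVars (f : MvPolynomial (ℕ ⊕ ℕ) ℤ) :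
    constantCoeff (shiftDoubleVars f) = constantCoeff f := by
  have : (constantCoeff.comp (shiftDoubleVars : _ →+* MvPolynomial (ℕ ⊕ ℕ) ℤ)) =
      (constantCoeff : MvPolynomial (ℕ ⊕ ℕ) ℤ →+* ℤ) :=
    ringHom_ext (by simp) (by rintro ((- | i) | (- | i)) <;> simp [shiftDoubleVars, dropFirst])
  exact DFunLike.congr_fun this f

theorem divDiff_sub {σ : Type} [DecidableEq σ] {a b : σ} (h : a ≠ b) (f g : MvPolynomial σ ℤ) :
    divDiff a b (f - g) = divDiff a b f - divDiff a b g := by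
  rw [sub_eq_add_neg, divDiff_add h, divDiff_neg h, ← sub_eq_add_neg]

/-- By induction on length both sides have the same divided differences in `x` and in `y`, and for
`w ≠ 1` both constant terms vanish. -/
theorem shiftDoubleVars_doubleSchubert (w : FinPerm) :
    shiftDoubleVars (doubleSchubert (oneTimes 1 w)) = doubleSchubert w := by
  induction hl : length w using Nat.strong_induction_on generalizing w with
  | _ l ih =>
    by_cases hw : w = 1
    · rw [hw, oneTimes_one, doubleSchubert_one, map_one]
    have hw' : oneTimes 1 w ≠ 1 := fun h => hw (oneTimes_injective 1 (h.trans (oneTimes_one 1).symm))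
    rw [← sub_eq_zero, eq_C_of_divDiff_inl_eq_zero_of_divDiff_inr_eq_zero
      (f := shiftDoubleVars (doubleSchubert (oneTimes 1 w)) - doubleSchubert w), map_sub,
      constantCoeff_shiftDoubleVars, constantCoeff_doubleSchubert hw,
      constantCoeff_doubleSchubert hw', sub_zero, map_zero]
    · intro i
      rw [divDiff_sub (inl_ne_inl_succ i), ← shiftDoubleVars_divDiff_inl]
      rcases apply_lt_or_gt w i with h | h
      · rw [divDiff_inl_doubleSchubert_eq_zero h, divDiff_inl_doubleSchubert_eq_zero, map_zero,
          sub_zero]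
        simpa only [oneTimes_one_succ, Nat.add_lt_add_iff_right]
      · have := length_mul_simple w i h
        rw [divDiff_inl_doubleSchubert h, divDiff_inl_doubleSchubert, ← oneTimes_simple,
          ← oneTimes_mul, ih _ (by omega) _ rfl, sub_self]
        simpa only [oneTimes_one_succ, Nat.add_lt_add_iff_right]
    · intro i
      rw [divDiff_sub (inr_ne_inr_succ i), ← shiftDoubleVars_divDiff_inr]
      rcases apply_lt_or_gt w⁻¹ i with h | h
      · rw [divDiff_inr_doubleSchubert_eq_zero h, divDiff_inr_doubleSchubert_eq_zero, map_zero,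
          sub_zero]
        simpa only [oneTimes_inv, oneTimes_one_succ, Nat.add_lt_add_iff_right]
      · have := length_simple_mul w i h
        rw [divDiff_inr_doubleSchubert h, divDiff_inr_doubleSchubert, ← oneTimes_simple,
          ← oneTimes_mul, map_neg, ih _ (by omega) _ rfl, sub_self]
        simpa only [oneTimes_inv, oneTimes_one_succ, Nat.add_lt_add_iff_right]

theorem shiftVars_schubert_oneTimes (w : FinPerm) :
    shiftVars (schubert (oneTimes 1 w)) = schubert w := by
  have : shiftVars.comp setYZero = setYZero.comp shiftDoubleVars :=
    algHom_ext (by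
      rintro ((- | i) | (- | i)) <;> simp [shiftDoubleVars, shiftVars, setYZero, dropFirst])
  rw [schubert_eq_setYZero, schubert_eq_setYZero, ← shiftDoubleVars_doubleSchubert w]
  exact DFunLike.congr_fun this _

/-- Its divided differences are specializations of `0` or of `𝔖_{w s_{i+1}}`. Since `s_{i+1}` leaves
the first position alone, induction kills all of them, and the constant term is zero. -/
theorem shiftVars_schubert_eq_zero {w : FinPerm} (h0 : w.1 0 ≠ 0) :
    shiftVars (schubert w) = 0 := by
  induction hl : length w using Nat.strong_induction_on generalizing w with
  | _ l ih =>
    have hw : w ≠ 1 := fun h => h0 (by rw [h]; rfl)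
    rw [eq_C_of_divDiff_eq_zero (f := shiftVars (schubert w)), constantCoeff_shiftVars,
      constantCoeff_schubert hw, map_zero]
    intro i
    rw [← shiftVars_divDiff]
    rcases apply_lt_or_gt w (i + 1) with h | h
    · rw [divDiff_schubert_eq_zero h, map_zero]
    · have := length_mul_simple w (i + 1) h
      rw [divDiff_schubert h]
      refine ih _ (by omega) ?_ rfl
      rwa [mul_simple_apply_of_ne w (by omega) (by omega)]

/-- The substitution `x_j = -y_j`. -/
noncomputable def toNegY : MvPolynomial ℕ ℤ →ₐ[ℤ] MvPolynomial (ℕ ⊕ ℕ) ℤ :=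
  aeval fun j => -X (Sum.inr j)

theorem schubertPair_eq (p : FinPerm × FinPerm) :
    schubertPair p = rename Sum.inl (schubert p.1) * toNegY (schubert p.2) := rfl

theorem shiftDoubleVars_rename_inl (f : MvPolynomial ℕ ℤ) :
    shiftDoubleVars (rename Sum.inl f) = rename Sum.inl (shiftVars f) := by
  have : shiftDoubleVars.comp (rename Sum.inl) = (rename Sum.inl).comp shiftVars :=
    algHom_ext (by rintro (- | i) <;> simp [shiftDoubleVars, shiftVars, dropFirst])
  exact DFunLike.congr_fun this f

theorem shiftDoubleVars_toNegY (f : MvPolynomial ℕ ℤ) :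
    shiftDoubleVars (toNegY f) = toNegY (shiftVars f) := by
  have : shiftDoubleVars.comp toNegY = toNegY.comp shiftVars :=
    algHom_ext (by rintro (- | i) <;> simp [shiftDoubleVars, shiftVars, dropFirst, toNegY])
  exact DFunLike.congr_fun this f

theorem shiftDoubleVars_schubertPair_oneTimesPair (p : FinPerm × FinPerm) :
    shiftDoubleVars (schubertPair (oneTimesPair 1 p)) = schubertPair p := by
  rw [schubertPair_eq, schubertPair_eq, map_mul, shiftDoubleVars_rename_inl,
    shiftDoubleVars_toNegY, oneTimesPair, shiftVars_schubert_oneTimes,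
    shiftVars_schubert_oneTimes]

theorem shiftDoubleVars_schubertPair_eq_zero {p : FinPerm × FinPerm}
    (h : p.1.1 0 ≠ 0 ∨ p.2.1 0 ≠ 0) : shiftDoubleVars (schubertPair p) = 0 := by
  rw [schubertPair_eq, map_mul, shiftDoubleVars_rename_inl, shiftDoubleVars_toNegY]
  rcases h with h | h
  · rw [shiftVars_schubert_eq_zero h, map_zero, zero_mul]
  · rw [shiftVars_schubert_eq_zero h, map_zero, mul_zero]

end Shift

/-! ### Schubert bases and their dual functionals -/

section Basis

open FinPerm

/-- The coefficient of `𝔖_w` in the expansion of a polynomial in Schubert polynomials: the constant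
term of its image under `∂_w`. -/
noncomputable def schubertCoeff (w : FinPerm) : MvPolynomial ℕ ℤ →+ ℤ where
  toFun f := constantCoeff (divDiffPerm id w f)
  map_zero' := by rw [divDiffPerm_zero Function.injective_id, map_zero]
  map_add' f g := by rw [divDiffPerm_add Function.injective_id, map_add]

theorem schubertCoeff_apply (w : FinPerm) (f : MvPolynomial ℕ ℤ) :
    schubertCoeff w f = constantCoeff (divDiffPerm id w f) := rfl

theorem schubertCoeff_one (f : MvPolynomial ℕ ℤ) : schubertCoeff 1 f = constantCoeff f := by
  rw [schubertCoeff_apply, divDiffPerm_one Function.injective_id]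

theorem schubertCoeff_of_descent {w : FinPerm} {i : ℕ} (h : w.1 (i + 1) < w.1 i)
    (f : MvPolynomial ℕ ℤ) :
    schubertCoeff w f = schubertCoeff (w * simple i) (divDiff i (i + 1) f) := by
  rw [schubertCoeff_apply, divDiffPerm_of_descent Function.injective_id h]
  rfl

open Classical in
-- Descents of `v` are removed from `v` and `w` simultaneously; if one is not a descent of `w`, the
-- result is zero.
theorem schubertCoeff_schubert (v w : FinPerm) :
    schubertCoeff v (schubert w) = if v = w then 1 else 0 := by
  induction v using descent_induction generalizing w with
  | one =>
    rw [schubertCoeff_one]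
    split_ifs with h
    · rw [← h, schubert_one, map_one]
    · exact constantCoeff_schubert (Ne.symm h)
  | descent v i hi ih =>
    rw [schubertCoeff_of_descent hi]
    rcases apply_lt_or_gt w i with h | h
    · rw [divDiff_schubert_eq_zero h, map_zero, if_neg]
      rintro rfl
      omega
    · rw [divDiff_schubert h, ih]
      simp only [mul_left_inj]

theorem finite_setOf_divDiff_ne_zero (f : MvPolynomial ℕ ℤ) :
    {i | divDiff i (i + 1) f ≠ 0}.Finite := by
  induction f using MvPolynomial.induction_on with
  | C r =>
    refine Set.Finite.subset Set.finite_empty fun i hi => hi ?_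
    exact (divDiff_eq_zero_iff (by omega)).2 (rename_C _ _)
  | add p q hp hq =>
    refine (hp.union hq).subset fun i hi => ?_
    by_contra h
    simp only [Set.mem_union, Set.mem_ofPred_eq, not_or, not_not] at h
    exact hi (by rw [divDiff_add (by omega), h.1, h.2, add_zero])
  | mul_X p c hp =>
    refine (hp.union ((Set.finite_le_nat c))).subset fun i hi => ?_
    by_contra h
    simp only [Set.mem_union, Set.mem_ofPred_eq, not_or, not_not, not_le] at h
    refine hi ?_
    rw [divDiff_mul_of_rename_eq (by omega), h.1, zero_mul]
    rw [rename_X, Equiv.swap_apply_of_ne_of_ne (by omega) (by omega)]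

/-- A contributing `w ≠ 1` has a descent `i` with `∂_i f ≠ 0`. Only finitely many `i` qualify, and
each `∂_i f` has smaller degree. -/
theorem finite_setOf_schubertCoeff_ne_zero (f : MvPolynomial ℕ ℤ) :
    {w | schubertCoeff w f ≠ 0}.Finite := by
  induction hd : f.totalDegree using Nat.strong_induction_on generalizing f with
  | _ d ih =>
    have hfin : ∀ i, {w | schubertCoeff w (divDiff i (i + 1) f) ≠ 0}.Finite := by
      intro i
      by_cases h0 : divDiff i (i + 1) f = 0
      · rw [h0]
        simp
      · have := totalDegree_divDiff_lt (by omega) h0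
        exact ih _ (by omega) _ rfl
    refine ((Set.finite_singleton 1).union ((finite_setOf_divDiff_ne_zero f).biUnion
      fun i _ => (hfin i).image (· * simple i))).subset fun w hw => ?_
    by_cases h1 : w = 1
    · exact Or.inl h1
    obtain ⟨i, hi⟩ := exists_descent h1
    have hw' : schubertCoeff w f ≠ 0 := hw
    rw [schubertCoeff_of_descent hi] at hw'
    refine Or.inr (Set.mem_biUnion (x := i) (fun h0 => hw' (by rw [h0, map_zero])) ?_)
    exact ⟨w * simple i, hw', mul_simple_mul_simple w i⟩

theorem eq_zero_of_schubertCoeff_eq_zero {f : MvPolynomial ℕ ℤ}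
    (h : ∀ w, schubertCoeff w f = 0) : f = 0 := by
  induction hd : f.totalDegree using Nat.strong_induction_on generalizing f with
  | _ d ih =>
    rw [eq_C_of_divDiff_eq_zero (f := f), ← schubertCoeff_one, h, map_zero]
    intro i
    by_contra h0
    have := totalDegree_divDiff_lt (by omega) h0
    refine h0 (ih _ (by omega) (fun w => ?_) rfl)
    -- At an ascent the coefficient of `w` in `∂_i f` is that of `w s_i` in `f`; at a descent `∂_i
    -- ∂_i = 0` applies.
    rcases apply_lt_or_gt w i with hw | hw
    · have h1 := schubertCoeff_of_descent (w := w * simple i) (i := i)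
        (by rwa [mul_simple_apply_left, mul_simple_apply_right]) f
      rw [mul_simple_mul_simple, h] at h1
      exact h1.symm
    · rw [schubertCoeff_of_descent hw, divDiff_divDiff_self (by omega), map_zero]

theorem mem_span_schubert (f : MvPolynomial ℕ ℤ) : f ∈ Submodule.span ℤ (Set.range schubert) := by
  classical
  set S := (finite_setOf_schubertCoeff_ne_zero f).toFinset with hS
  have : f - ∑ w ∈ S, schubertCoeff w f • schubert w = 0 := by
    refine eq_zero_of_schubertCoeff_eq_zero fun v => ?_
    rw [map_sub, map_sum]
    simp only [map_zsmul, schubertCoeff_schubert, smul_eq_mul, mul_ite, mul_one, mul_zero,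
      Finset.sum_ite_eq]
    split_ifs with hv
    · exact sub_self _
    · rw [sub_zero]
      by_contra h
      exact hv (by simpa [hS] using h)
  rw [sub_eq_zero.1 this]
  exact Submodule.sum_mem _ fun w _ =>
    Submodule.smul_mem _ _ (Submodule.subset_span (Set.mem_range_self w))

theorem mul_toNegY_mem_span (f g : MvPolynomial ℕ ℤ) :
    rename Sum.inl f * toNegY g ∈ Submodule.span ℤ (Set.range schubertPair) := by
  induction mem_span_schubert f using Submodule.span_induction with
  | mem f hf =>
    obtain ⟨u, rfl⟩ := hf
    induction mem_span_schubert g using Submodule.span_induction with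
    | mem g hg =>
      obtain ⟨v, rfl⟩ := hg
      exact Submodule.subset_span ⟨(u, v), rfl⟩
    | zero => simp
    | add g g' _ _ h h' => rw [map_add, mul_add]; exact Submodule.add_mem _ h h'
    | smul a g _ h => rw [map_zsmul, mul_smul_comm]; exact Submodule.smul_mem _ a h
  | zero => simp
  | add f f' _ _ h h' => rw [map_add, add_mul]; exact Submodule.add_mem _ h h'
  | smul a f _ h => rw [map_zsmul, smul_mul_assoc]; exact Submodule.smul_mem _ a h

theorem mem_span_mul_toNegY (F : MvPolynomial (ℕ ⊕ ℕ) ℤ) :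
    F ∈ Submodule.span ℤ (Set.range fun q : MvPolynomial ℕ ℤ × MvPolynomial ℕ ℤ =>
      rename Sum.inl q.1 * toNegY q.2) := by
  induction F using MvPolynomial.induction_on with
  | C r => exact Submodule.subset_span ⟨(C r, 1), by simp⟩
  | add p q hp hq => exact Submodule.add_mem _ hp hq
  | mul_X p c hp =>
    induction hp using Submodule.span_induction with
    | mem p hp =>
      obtain ⟨⟨f, g⟩, rfl⟩ := hp
      rcases c with i | j
      · exact Submodule.subset_span ⟨(f * X i, g), by simp only [map_mul, rename_X]; ring⟩
      · exact Submodule.subset_span ⟨(f, g * -X j), by simp [toNegY]; ring⟩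
    | zero => simp
    | add p q _ _ hp hq => rw [add_mul]; exact Submodule.add_mem _ hp hq
    | smul a p _ hp => rw [smul_mul_assoc]; exact Submodule.smul_mem _ a hp

theorem span_schubertPair : ⊤ ≤ Submodule.span ℤ (Set.range schubertPair) := by
  refine le_trans (fun F _ => mem_span_mul_toNegY F) (Submodule.span_le.2 ?_)
  rintro _ ⟨⟨f, g⟩, rfl⟩
  exact mul_toNegY_mem_span f g

/-- The coefficient of `𝔖_p` in the expansion of a polynomial in the products `𝔖_u(x) 𝔖_v(-y)`. -/
noncomputable def pairCoeff (p : FinPerm × FinPerm) : MvPolynomial (ℕ ⊕ ℕ) ℤ →+ ℤ where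
  -- Under `x = -y` each divided difference changes sign, once per letter of `v`; the power of `-1`
  -- compensates.
  toFun F := (-1) ^ length p.2 *
    constantCoeff (divDiffPerm Sum.inl p.1 (divDiffPerm Sum.inr p.2 F))
  map_zero' := by
    rw [divDiffPerm_zero Sum.inr_injective, divDiffPerm_zero Sum.inl_injective, map_zero, mul_zero]
  map_add' f g := by
    rw [divDiffPerm_add Sum.inr_injective, divDiffPerm_add Sum.inl_injective, map_add, mul_add]

theorem pairCoeff_apply (p : FinPerm × FinPerm) (F : MvPolynomial (ℕ ⊕ ℕ) ℤ) :
    pairCoeff p F = (-1) ^ length p.2 *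
      constantCoeff (divDiffPerm Sum.inl p.1 (divDiffPerm Sum.inr p.2 F)) := rfl

theorem divDiff_rename_inl (i : ℕ) (f : MvPolynomial ℕ ℤ) :
    divDiff (Sum.inl i) (Sum.inl (i + 1)) (rename Sum.inl f : MvPolynomial (ℕ ⊕ ℕ) ℤ) =
      rename Sum.inl (divDiff i (i + 1) f) :=
  (algHom_divDiff (inl_ne_inl_succ i) (rename Sum.inl) (by simp)
    (fun j => by simp [rename_X, swap_inl_inl]) f).symm

theorem divDiff_toNegY (i : ℕ) (f : MvPolynomial ℕ ℤ) :
    divDiff (Sum.inr i) (Sum.inr (i + 1)) (toNegY f) = -toNegY (divDiff i (i + 1) f) := by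
  rw [← mul_algHom_divDiff (a := i) (b := i + 1) (inr_ne_inr_succ i) toNegY (-1)
    (by simp [toNegY]; ring) (fun j => by simp [toNegY, rename_X, swap_inr_inr]) f]
  ring

theorem divDiffPerm_rename_inl (w : FinPerm) (f : MvPolynomial ℕ ℤ) :
    divDiffPerm Sum.inl w (rename Sum.inl f : MvPolynomial (ℕ ⊕ ℕ) ℤ) =
      rename Sum.inl (divDiffPerm id w f) := by
  induction w using descent_induction generalizing f with
  | one => rw [divDiffPerm_one Sum.inl_injective, divDiffPerm_one Function.injective_id]
  | descent w i hi ih =>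
    rw [divDiffPerm_of_descent Sum.inl_injective hi, divDiff_rename_inl, ih,
      divDiffPerm_of_descent Function.injective_id hi]
    rfl

theorem divDiffPerm_toNegY (w : FinPerm) (f : MvPolynomial ℕ ℤ) :
    divDiffPerm Sum.inr w (toNegY f) = toNegY ((-1) ^ length w * divDiffPerm id w f) := by
  induction w using descent_induction generalizing f with
  | one => simp [divDiffPerm_one Sum.inr_injective, divDiffPerm_one Function.injective_id]
  | descent w i hi ih =>
    rw [divDiffPerm_of_descent Sum.inr_injective hi, divDiff_toNegY,
      divDiffPerm_neg Sum.inr_injective, ih, divDiffPerm_of_descent Function.injective_id hi,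
      ← length_mul_simple w i hi, pow_succ, ← map_neg]
    congr 1
    simp only [id]
    ring

theorem rename_swap_inr_rename_inl (j : ℕ) (f : MvPolynomial ℕ ℤ) :
    rename (Equiv.swap (Sum.inr j) (Sum.inr (j + 1))) (rename Sum.inl f) =
      (rename Sum.inl f : MvPolynomial (ℕ ⊕ ℕ) ℤ) := by
  rw [rename_rename]
  congr 2

theorem rename_swap_inl_toNegY (i : ℕ) (f : MvPolynomial ℕ ℤ) :
    rename (Equiv.swap (Sum.inl i) (Sum.inl (i + 1))) (toNegY f) = toNegY f := by
  have : (rename (Equiv.swap (Sum.inl i : ℕ ⊕ ℕ) (Sum.inl (i + 1)))).comp toNegY = toNegY :=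
    algHom_ext fun j => by simp [toNegY, rename_X, swap_inl_inr]
  exact DFunLike.congr_fun this f

theorem constantCoeff_toNegY (f : MvPolynomial ℕ ℤ) :
    constantCoeff (toNegY f) = constantCoeff f := by
  have : (constantCoeff.comp (toNegY : _ →+* MvPolynomial (ℕ ⊕ ℕ) ℤ)) =
      (constantCoeff : MvPolynomial ℕ ℤ →+* ℤ) :=
    ringHom_ext (by simp) (by intro i; simp [toNegY])
  exact DFunLike.congr_fun this f

theorem pairCoeff_mul_toNegY (p : FinPerm × FinPerm) (f g : MvPolynomial ℕ ℤ) :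
    pairCoeff p (rename Sum.inl f * toNegY g) = schubertCoeff p.1 f * schubertCoeff p.2 g := by
  rw [pairCoeff_apply, mul_comm (rename Sum.inl f),
    divDiffPerm_mul_of_rename_eq Sum.inr_injective (fun j => rename_swap_inr_rename_inl j f),
    divDiffPerm_toNegY, mul_comm (toNegY _),
    divDiffPerm_mul_of_rename_eq Sum.inl_injective (fun i => rename_swap_inl_toNegY i _),
    divDiffPerm_rename_inl, map_mul, constantCoeff_rename, constantCoeff_toNegY, map_mul, map_pow,
    map_neg, map_one, schubertCoeff_apply, schubertCoeff_apply]
  have : ((-1 : ℤ) ^ length p.2) * (-1) ^ length p.2 = 1 := by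
    rw [← mul_pow]; simp
  linear_combination (constantCoeff (divDiffPerm id p.1 f) *
    constantCoeff (divDiffPerm id p.2 g)) * this

open Classical in
theorem pairCoeff_schubertPair (p q : FinPerm × FinPerm) :
    pairCoeff p (schubertPair q) = if p = q then 1 else 0 := by
  rw [schubertPair_eq, pairCoeff_mul_toNegY, schubertCoeff_schubert, schubertCoeff_schubert]
  simp only [Prod.ext_iff]
  split_ifs <;> simp_all

theorem linearIndependent_schubertPair : LinearIndependent ℤ schubertPair := by
  classical
  rw [linearIndependent_iff']
  intro s g h p hp
  have := congrArg (pairCoeff p) h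
  simp only [map_sum, map_zsmul, pairCoeff_schubertPair, map_zero] at this
  simpa [hp] using this

/-- The products `𝔖_u(x) 𝔖_v(-y)` form a basis of `ℤ[x, y]`. -/
noncomputable def schubertPairBasis :
    Module.Basis (FinPerm × FinPerm) ℤ (MvPolynomial (ℕ ⊕ ℕ) ℤ) :=
  Module.Basis.mk linearIndependent_schubertPair span_schubertPair

theorem schubertPairBasis_apply (p : FinPerm × FinPerm) :
    schubertPairBasis p = schubertPair p :=
  Module.Basis.mk_apply _ _ p

/-- Coordinates become constant terms of divided differences, so that symmetry and degree of a
polynomial restrict its expansion. -/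
theorem schubertPairBasis_repr_apply (F : MvPolynomial (ℕ ⊕ ℕ) ℤ) (p : FinPerm × FinPerm) :
    schubertPairBasis.repr F p = pairCoeff p F := by
  classical
  conv_rhs => rw [← schubertPairBasis.linearCombination_repr F]
  simp only [Finsupp.linearCombination_apply, Finsupp.sum, map_sum, map_zsmul,
    schubertPairBasis_apply, pairCoeff_schubertPair]
  simp

end Basis

/-! ### Weak stability of the expansion -/

section Stability

open FinPerm

theorem oneTimesPair_injective (n : ℕ) : Function.Injective (oneTimesPair n) := fun _ _ h =>
  Prod.ext (oneTimes_injective n (congrArg Prod.fst h)) (oneTimes_injective n (congrArg Prod.snd h))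

theorem oneTimesPair_zero (p : FinPerm × FinPerm) : oneTimesPair 0 p = p :=
  Prod.ext (oneTimes_zero _) (oneTimes_zero _)

theorem oneTimesPair_oneTimesPair (m n : ℕ) (p : FinPerm × FinPerm) :
    oneTimesPair m (oneTimesPair n p) = oneTimesPair (m + n) p :=
  Prod.ext (oneTimes_oneTimes _ _ _) (oneTimes_oneTimes _ _ _)

theorem exists_eq_oneTimesPair_one {p : FinPerm × FinPerm}
    (h : ¬ (p.1.1 0 ≠ 0 ∨ p.2.1 0 ≠ 0)) : ∃ q, p = oneTimesPair 1 q := by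
  simp only [ne_eq, not_or, not_not] at h
  obtain ⟨u, hu⟩ := exists_eq_oneTimes_one h.1
  obtain ⟨v, hv⟩ := exists_eq_oneTimes_one h.2
  exact ⟨(u, v), Prod.ext hu hv⟩

/-- In the basis expansion of `F` the specialization keeps exactly the terms indexed by `1 × q`,
relabelled by `q`. -/
theorem pairCoeff_shiftDoubleVars (F : MvPolynomial (ℕ ⊕ ℕ) ℤ) (q : FinPerm × FinPerm) :
    pairCoeff q (shiftDoubleVars F) = pairCoeff (oneTimesPair 1 q) F := by
  classical
  conv_lhs => rw [← schubertPairBasis.linearCombination_repr F]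
  conv_rhs => rw [← schubertPairBasis.linearCombination_repr F]
  simp only [Finsupp.linearCombination_apply, Finsupp.sum, map_sum, map_zsmul,
    schubertPairBasis_apply, pairCoeff_schubertPair]
  refine Finset.sum_congr rfl fun p _ => congrArg _ ?_
  by_cases hp : p.1.1 0 ≠ 0 ∨ p.2.1 0 ≠ 0
  · rw [shiftDoubleVars_schubertPair_eq_zero hp, map_zero, if_neg]
    rintro rfl
    rcases hp with hp | hp <;> exact hp (oneTimes_apply_lt _ Nat.zero_lt_one)
  · obtain ⟨p, rfl⟩ := exists_eq_oneTimesPair_one hp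
    rw [shiftDoubleVars_schubertPair_oneTimesPair, pairCoeff_schubertPair]
    simp only [(oneTimesPair_injective 1).eq_iff]

theorem divDiff_prod_eq_zero {σ : Type} [DecidableEq σ] {a b : σ} (h : a ≠ b) {ι : Type*}
    (s : Finset ι) (f : ι → MvPolynomial σ ℤ) (hf : ∀ t ∈ s, divDiff a b (f t) = 0) :
    divDiff a b (∏ t ∈ s, f t) = 0 := by
  rw [divDiff_eq_zero_iff h, map_prod]
  exact Finset.prod_congr rfl fun t ht => (divDiff_eq_zero_iff h).1 (hf t ht)

theorem oneTimes_lt_succ (w : FinPerm) {n i : ℕ} (h : i + 1 < n) :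
    (oneTimes n w).1 i < (oneTimes n w).1 (i + 1) := by
  rw [oneTimes_apply_lt w h, oneTimes_apply_lt w (by omega)]
  omega

theorem divDiff_inl_doubleSchubert_oneTimes (w : FinPerm) {n i : ℕ} (h : i + 1 < n) :
    divDiff (Sum.inl i) (Sum.inl (i + 1)) (doubleSchubert (oneTimes n w)) = 0 :=
  divDiff_inl_doubleSchubert_eq_zero (oneTimes_lt_succ w h)

theorem divDiff_inr_doubleSchubert_oneTimes (w : FinPerm) {n i : ℕ} (h : i + 1 < n) :
    divDiff (Sum.inr i) (Sum.inr (i + 1)) (doubleSchubert (oneTimes n w)) = 0 :=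
  divDiff_inr_doubleSchubert_eq_zero (oneTimes_lt_succ w⁻¹ h)

theorem length_oneTimes (n : ℕ) (w : FinPerm) : length (oneTimes n w) = length w := by
  induction w using descent_induction with
  | one => rw [oneTimes_one]
  | descent w i hi ih =>
    rw [← length_mul_simple w i hi, ← ih, oneTimes_mul, oneTimes_simple,
      length_mul_simple (oneTimes n w) (i + n)]
    simpa [oneTimes_apply, show i + n + 1 - n = i + 1 by omega,
      show ¬ (i + n + 1 < n) by omega] using hi

theorem divDiffPerm_comm {σ : Type} [DecidableEq σ] {x y : ℕ → σ} (hx : Function.Injective x)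
    (hy : Function.Injective y) (hxy : ∀ i j, x i ≠ y j) (u v : FinPerm) (f : MvPolynomial σ ℤ) :
    divDiffPerm x u (divDiffPerm y v f) = divDiffPerm y v (divDiffPerm x u f) := by
  induction u using descent_induction generalizing f with
  | one => simp only [divDiffPerm_one hx]
  | descent u i hi ih =>
    rw [divDiffPerm_of_descent hx hi, divDiffPerm_of_descent hx hi,
      divDiff_divDiffPerm_comm hy (hx.ne (by omega)) (hxy i) (hxy (i + 1)), ih]

/-- If `F` has degree less than `n` and is symmetric in the first `n` variables of the sequence
`x`, then `∂_w F ≠ 0` only for permutations `w` that fix the first letter. -/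
theorem apply_zero_of_divDiffPerm_ne_zero {σ : Type} [DecidableEq σ] {x : ℕ → σ}
    (hx : Function.Injective x) {F : MvPolynomial σ ℤ} {n : ℕ} (hdeg : F.totalDegree < n)
    (hsymm : ∀ i, i + 1 < n → divDiff (x i) (x (i + 1)) F = 0) {w : FinPerm}
    (h : divDiffPerm x w F ≠ 0) : w.1 0 = 0 := by
  by_contra h0
  -- At a descent `i` of `w`, the operator `∂_w` can apply `∂_i` first, which kills `F` when `i + 1
  -- < n`; so `w` increases on the first `n` letters.
  have hlen : n ≤ length w := by
    refine le_length_of_forall_lt (fun i hi => ?_) h0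
    refine (apply_lt_or_gt w i).resolve_right fun hd => h ?_
    rw [divDiffPerm_of_descent hx hd, hsymm i hi, divDiffPerm_zero hx]
  exact h (divDiffPerm_eq_zero_of_totalDegree_lt hx (by omega))

theorem totalDegree_prod_doubleSchubert_le {r : ℕ} (w : Fin r → FinPerm) (n : ℕ) :
    (∏ t, doubleSchubert (oneTimes n (w t))).totalDegree ≤ ∑ t, length (w t) := by
  refine (IsHomogeneous.prod Finset.univ _ _ fun t _ => ?_).totalDegree_le
  have := doubleSchubert_isHomogeneous (oneTimes n (w t))
  rwa [length_oneTimes] at this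

theorem apply_zero_of_pairCoeff_ne_zero {r : ℕ} {w : Fin r → FinPerm} {n : ℕ}
    (hn : ∑ t, length (w t) < n) {p : FinPerm × FinPerm}
    (hp : pairCoeff p (∏ t, doubleSchubert (oneTimes n (w t))) ≠ 0) :
    p.1.1 0 = 0 ∧ p.2.1 0 = 0 := by
  have hdeg := (totalDegree_prod_doubleSchubert_le w n).trans_lt hn
  have h : divDiffPerm Sum.inl p.1 (divDiffPerm Sum.inr p.2
      (∏ t, doubleSchubert (oneTimes n (w t)))) ≠ 0 := fun h0 =>
    hp (by rw [pairCoeff_apply, h0, map_zero, mul_zero])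
  constructor
  -- The `x` operator must act directly on the product, whose symmetry and degree are known, so it
  -- is moved inside.
  · rw [divDiffPerm_comm Sum.inl_injective Sum.inr_injective fun _ _ => Sum.inl_ne_inr] at h
    refine apply_zero_of_divDiffPerm_ne_zero Sum.inl_injective hdeg (fun i hi => ?_)
      (fun h0 => h (by rw [h0, divDiffPerm_zero Sum.inr_injective]))
    exact divDiff_prod_eq_zero (inl_ne_inl_succ i) _ _
      fun t _ => divDiff_inl_doubleSchubert_oneTimes (w t) hi
  · refine apply_zero_of_divDiffPerm_ne_zero Sum.inr_injective hdeg (fun i hi => ?_)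
      (fun h0 => h (by rw [h0, divDiffPerm_zero Sum.inl_injective]))
    exact divDiff_prod_eq_zero (inr_ne_inr_succ i) _ _
      fun t _ => divDiff_inr_doubleSchubert_oneTimes (w t) hi

/-- The expansion of the product of the double Schubert polynomials of `1^n × w_t`. -/
noncomputable def productExpansion {r : ℕ} (w : Fin r → FinPerm) (n : ℕ) :
    FinPerm × FinPerm →₀ ℤ :=
  schubertPairBasis.repr (∏ t, doubleSchubert (oneTimes n (w t)))

variable {r : ℕ} (w : Fin r → FinPerm)

theorem sum_productExpansion (n : ℕ) :
    ∑ p ∈ (productExpansion w n).support, productExpansion w n p • schubertPair p =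
      ∏ t, doubleSchubert (oneTimes n (w t)) := by
  conv_rhs => rw [← schubertPairBasis.linearCombination_repr (∏ t, _)]
  simp only [Finsupp.linearCombination_apply, schubertPairBasis_apply]
  rfl

theorem prod_eq_sum_iff (n : ℕ) (d : FinPerm × FinPerm →₀ ℤ) :
    ∏ t, doubleSchubert (oneTimes n (w t)) = (d.sum fun p a => a • schubertPair p) ↔
      d = productExpansion w n := by
  have : (d.sum fun p a => a • schubertPair p) = schubertPairBasis.repr.symm d := by
    simp only [Module.Basis.repr_symm_apply, Finsupp.linearCombination_apply,
      schubertPairBasis_apply]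
  rw [this, productExpansion, LinearEquiv.eq_symm_apply, eq_comm]

/-- The specialization is multiplicative, hence takes the product for `n + 1` to the product for
`n`. -/
theorem productExpansion_succ_oneTimesPair (n : ℕ) (p : FinPerm × FinPerm) :
    productExpansion w (n + 1) (oneTimesPair 1 p) = productExpansion w n p := by
  rw [productExpansion, productExpansion, schubertPairBasis_repr_apply,
    schubertPairBasis_repr_apply, ← pairCoeff_shiftDoubleVars, map_prod]
  congr 2 with t
  rw [add_comm, ← oneTimes_oneTimes, shiftDoubleVars_doubleSchubert]

theorem prod_succ_eq (n : ℕ) :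
    ∏ t, doubleSchubert (oneTimes (n + 1) (w t)) =
      ∑ p ∈ (productExpansion w n).support,
        productExpansion w n p • schubertPair (oneTimesPair 1 p) +
      ∑ p ∈ newPairs (productExpansion w) (n + 1),
        productExpansion w (n + 1) p • schubertPair p := by
  classical
  have hsub : (productExpansion w n).support.image (oneTimesPair 1) ⊆
      (productExpansion w (n + 1)).support := by
    intro p hp
    obtain ⟨q, hq, rfl⟩ := Finset.mem_image.1 hp
    rw [Finsupp.mem_support_iff] at hq ⊢
    rwa [productExpansion_succ_oneTimesPair]
  rw [← sum_productExpansion, ← Finset.sum_sdiff hsub, add_comm,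
    Finset.sum_image (oneTimesPair_injective 1).injOn]
  simp only [productExpansion_succ_oneTimesPair]
  congr 2

/-- A pair that fixes both first letters is `1 × q`, and its coefficient already occurred at `q` one
step earlier, so it is not new. -/
theorem apply_zero_ne_of_mem_newPairs {n : ℕ} {p : FinPerm × FinPerm}
    (hp : p ∈ newPairs (productExpansion w) (n + 1)) : p.1.1 0 ≠ 0 ∨ p.2.1 0 ≠ 0 := by
  classical
  by_contra h
  obtain ⟨q, rfl⟩ := exists_eq_oneTimesPair_one h
  simp only [newPairs, Finset.mem_sdiff, Finsupp.mem_support_iff,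
    productExpansion_succ_oneTimesPair] at hp
  exact hp.2 (Finset.mem_image.2 ⟨q, Finsupp.mem_support_iff.2 hp.1, rfl⟩)

theorem newPairs_eq_empty {n : ℕ} (hn : ∑ t, length (w t) < n) :
    newPairs (productExpansion w) n = ∅ := by
  obtain ⟨m, rfl⟩ : ∃ m, n = m + 1 := ⟨n - 1, by omega⟩
  refine Finset.eq_empty_of_forall_notMem fun p hp => ?_
  have h1 := apply_zero_ne_of_mem_newPairs w hp
  simp only [newPairs, Finset.mem_sdiff, Finsupp.mem_support_iff] at hp
  have h2 := hp.1
  rw [productExpansion, schubertPairBasis_repr_apply] at h2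
  have h3 := apply_zero_of_pairCoeff_ne_zero hn h2
  exact h1.elim (fun h => h h3.1) fun h => h h3.2

/-- This form holds for all `n`; the bound `k` enters only when the empty sets of new pairs are
dropped. -/
theorem prod_eq_sum_newPairs (n : ℕ) :
    ∏ t, doubleSchubert (oneTimes n (w t)) =
      ∑ i ∈ Finset.range (n + 1), ∑ p ∈ newPairs (productExpansion w) i,
        productExpansion w i p • schubertPair (oneTimesPair (n - i) p) := by
  induction n with
  | zero =>
    rw [← sum_productExpansion]
    simp [newPairs, oneTimesPair_zero]
  | succ n ih =>
    -- The linear map `𝔖_p ↦ 𝔖_{1×p}`, available because the `𝔖_p` form a basis, turns the expansion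
    -- for `n` into the old part of the expansion for `n + 1`.
    let T : MvPolynomial (ℕ ⊕ ℕ) ℤ →ₗ[ℤ] MvPolynomial (ℕ ⊕ ℕ) ℤ :=
      schubertPairBasis.constr ℤ fun p => schubertPair (oneTimesPair 1 p)
    have hT : ∀ p, T (schubertPair p) = schubertPair (oneTimesPair 1 p) := fun p => by
      rw [← schubertPairBasis_apply]
      exact schubertPairBasis.constr_basis ℤ _ p
    rw [← sum_productExpansion] at ih
    have h := congrArg T ih
    simp only [map_sum, map_smul, hT, oneTimesPair_oneTimesPair] at h
    rw [prod_succ_eq, h, Finset.sum_range_succ _ (n + 1), Nat.sub_self]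
    simp only [oneTimesPair_zero]
    congr 1
    refine Finset.sum_congr rfl fun i hi => ?_
    rw [Finset.mem_range] at hi
    rw [show 1 + (n - i) = n + 1 - i by omega]

end Stability

theorem mainTheorem8 (r : ℕ) (w : Fin r → FinPerm) :
    ∃ c : ℕ → (FinPerm × FinPerm →₀ ℤ),
      -- `c n` is the unique expansion of the product for `1^n × w₁, …, 1^n × w_r`
      (∀ (n : ℕ) (d : FinPerm × FinPerm →₀ ℤ),
        (∏ t, doubleSchubert (FinPerm.oneTimes n (w t)) = d.sum fun p a => a • schubertPair p) ↔
          d = c n) ∧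
      -- passing from `n` to `n + 1`
      (∀ n : ℕ,
        (∏ t, doubleSchubert (FinPerm.oneTimes (n + 1) (w t)) =
          ∑ p ∈ (c n).support, c n p • schubertPair (oneTimesPair 1 p) +
          ∑ p ∈ newPairs c (n + 1), c (n + 1) p • schubertPair p) ∧
        ∀ p ∈ newPairs c (n + 1), p.1.1 0 ≠ 0 ∨ p.2.1 0 ≠ 0) ∧
      -- stabilization from `n = k` on
      (∀ n : ℕ, (∑ t, FinPerm.length (w t)) ≤ n →
        ∏ t, doubleSchubert (FinPerm.oneTimes n (w t)) =
          ∑ i ∈ Finset.range ((∑ t, FinPerm.length (w t)) + 1),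
            ∑ p ∈ newPairs c i, c i p • schubertPair (oneTimesPair (n - i) p)) := by
  refine ⟨productExpansion w, prod_eq_sum_iff w,
    fun n => ⟨prod_succ_eq w n, fun p => apply_zero_ne_of_mem_newPairs w⟩, fun n hn => ?_⟩
  rw [prod_eq_sum_newPairs]
  symm
  -- The extra indices satisfy `k < i ≤ n`, where there are no new pairs.
  refine Finset.sum_subset (Finset.range_mono (by omega)) fun i _ hi => ?_
  rw [Finset.mem_range] at hi
  rw [newPairs_eq_empty w (by omega), Finset.sum_empty]
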